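/- Let $G=(V,E)$ be a finite simple graph that is maximal planar, i.e. $G$ is planar and no edge can be added to $G$ (on the same vertex set) without destroying planarity. (A finite graph is planar if it can be embedded in the sphere; combinatorially, if it has a rotation system for which every component has genus $0$.) Let $K$ be the set of 3-cliques (triangles) of $G$. A 3-clique $k$ of a graph is separating if the remaining vertices can be partitioned into two non-empty sets $S,S'$ such that every path from $S$ to $S'$ meets $k$. For every $k_i\in K$ let the interior $G^i_{in}$ and the exterior $G^i_{out}$ be the two parts into which the removal of $k_i$ divides $G$ (both non-empty if $k_i$ is separating, one of them empty otherwise), the interior being the part with fewer vertices; if both parts have the same number of vertices, the choice of the interior is arbitrary. The union $S_1\cup S_2$ of two subgraphs of $G$ has as vertices all vertices of $S_1$ and $S_2$, and as edges all edges of $G$ between these vertices. Put $k_i\preceq_K k_j$ if $(k_i\cup G^i_{in})\subseteq(k_j\cup G^j_{in})$, and say that $k_i$ covers $k_j$ if $k_j\neq k_i$, $k_j\preceq_K k_i$, and every $z\in K$ with $k_j\preceq_K z\preceq_K k_i$ equals $k_j$ or $k_i$. Let $H$ be the directed graph on $K$ with an edge from $k_j$ to $k_i$ whenever $k_i$ covers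 $k_j$; then $k_j$ is called an incoming neighbour of $k_i$. Theorem. For every such choice of interiors, and every 3-clique $k_i\in K$ that has at least one incoming neighbour in $H$, the union of $k_i$ with all of its incoming neighbours is a bubble, that is, a maximal planar graph all of whose 3-cliques are non-separating in it. -/

import Mathlib

namespace SimpleGraph

universe u

variable {V : Type u}

/-! ### Planar graphs

An embedding of a finite graph in an oriented closed surface is recorded by its rotation system:
around each vertex, the cyclic order in which the outgoing darts (oriented edges) are met. -/

/-- A rotation system: a permutation `next` of the darts of `G` whose cycles are exactly the sets
of darts leaving a common vertex, so that `next` is a cyclic order around every vertex. -/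
structure RotationSystem (G : SimpleGraph V) where
  next : Equiv.Perm G.Dart
  sameCycle_iff : ∀ d e : G.Dart, next.SameCycle d e ↔ d.fst = e.fst

namespace RotationSystem

variable {G : SimpleGraph V}

/-- The face permutation: traverse the dart `d` to its end point, then turn to the dart that
follows the reverse of `d` around that end point. Its cycles are the boundary walks of the
faces. -/
def faceStep (R : RotationSystem G) : Equiv.Perm G.Dart :=
  (Function.Involutive.toPerm Dart.symm Dart.symm_involutive).trans R.next

/-- The number of faces, counted component by component: one for each cycle of the face
permutation, and one for each isolated vertex (which has no darts, and is drawn on a sphere of its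
own with one face). -/
noncomputable def numFaces (R : RotationSystem G) : ℕ :=
  Nat.card (Quotient (Equiv.Perm.SameCycle.setoid R.faceStep)) +
    Nat.card {v : V // ∀ w, ¬ G.Adj v w}

/-- Every component is embedded in a sphere. Gluing a disc to every face turns each component into
a connected closed oriented surface, of Euler characteristic at most `2`, with equality exactly for
the sphere; hence all of them are spheres iff `|V| - |E| + |F| = 2 c`, where `c` is the number of
components. -/
def IsSpherical (R : RotationSystem G) : Prop :=
  Nat.card V + R.numFaces = Nat.card G.edgeSet + 2 * Nat.card G.ConnectedComponent

end RotationSystem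

/-- A finite graph is planar if it has a (combinatorial) embedding in the sphere. -/
def IsPlanar (G : SimpleGraph V) : Prop :=
  ∃ R : RotationSystem G, R.IsSpherical

/-- A graph is maximal planar if it is planar and no edge can be added to it, on the same vertices,
without losing planarity. -/
def IsMaximalPlanar (G : SimpleGraph V) : Prop :=
  Maximal IsPlanar G

/-! ### Separating 3-cliques, interior and exterior -/

/-- Removing the vertex set `C` divides `G` into the (possibly empty) parts `S` and `S'`: they
partition the remaining vertices, and every walk from `S` to `S'` meets `C`. -/
structure Divides (G : SimpleGraph V) (C S S' : Set V) : Prop where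
  disjoint : Disjoint S S'
  union_eq : S ∪ S' = Cᶜ
  meets : ∀ i ∈ S, ∀ j ∈ S', ∀ p : G.Walk i j, ∃ v ∈ p.support, v ∈ C

/-- `C` is separating in `G` if its removal divides `G` into two non-empty parts. -/
def IsSeparating (G : SimpleGraph V) (C : Set V) : Prop :=
  ∃ S S' : Set V, G.Divides C S S' ∧ S.Nonempty ∧ S'.Nonempty

/-- The set `K` of 3-cliques of `G`, each given by its vertices. -/
abbrev ThreeClique (G : SimpleGraph V) : Type u :=
  {k : Finset V // G.IsNClique 3 k}

/-- `I` and `O` can serve as (the vertex sets of) the interior and the exterior of the 3-clique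
`k`: they are the two parts obtained upon removal of `k`, both non-empty if `k` is separating, and
the interior is the one with fewer vertices. In case of a tie either part may be the interior. -/
structure IsInteriorExterior (G : SimpleGraph V) (k : ThreeClique G) (I O : Set V) : Prop where
  divides : G.Divides (k.1 : Set V) I O
  nonempty : G.IsSeparating (k.1 : Set V) → I.Nonempty ∧ O.Nonempty
  ncard_le : I.ncard ≤ O.ncard

/-- A choice of direction (interior and exterior) for all 3-cliques. It is arbitrary only
at ties. -/
structure CliqueDirection (G : SimpleGraph V) where
  interior : ThreeClique G → Set V
  exterior : ThreeClique G → Set V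
  isInteriorExterior : ∀ k, G.IsInteriorExterior k (interior k) (exterior k)

namespace CliqueDirection

variable {G : SimpleGraph V} (D : CliqueDirection G)

/-- `kᵢ ≼ kⱼ` iff `kᵢ ∪ Gⁱ_in ⊆ kⱼ ∪ Gʲ_in`. Unions of subgraphs carry all edges of `G` between
their vertices, so this is an inclusion of vertex sets. -/
def Below (i j : ThreeClique G) : Prop :=
  (i.1 : Set V) ∪ D.interior i ⊆ (j.1 : Set V) ∪ D.interior j

/-- `x` covers `y`: they are different, `y ≼ x`, and nothing else lies between them. -/
def Covers (x y : ThreeClique G) : Prop :=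
  y ≠ x ∧ D.Below y x ∧ ∀ z, D.Below y z → D.Below z x → z = y ∨ z = x

/-- The hierarchical graph `H`: an edge from `kⱼ` to `kᵢ` whenever `kᵢ` covers `kⱼ`. -/
def hierarchicalGraph : Digraph (ThreeClique G) where
  Adj j i := D.Covers i j

/-- The incoming neighbours of `i` in `H`. -/
def incomingNeighbors (i : ThreeClique G) : Set (ThreeClique G) :=
  {j | D.hierarchicalGraph.Adj j i}

/-- The vertices of the union of `i` with all its incoming neighbours in `H`. -/
def unionVerts (i : ThreeClique G) : Set V :=
  (i.1 : Set V) ∪ ⋃ j ∈ D.incomingNeighbors i, (j.1 : Set V)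

/-- The graph union of `i` with all its incoming neighbours in `H`; a graph union carries all
edges of `G` between its vertices. -/
def unionGraph (i : ThreeClique G) : SimpleGraph (D.unionVerts i) :=
  G.induce (D.unionVerts i)

end CliqueDirection

/-- A bubble: a maximal planar graph all of whose 3-cliques are non-separating. -/
def IsBubble (G : SimpleGraph V) : Prop :=
  G.IsMaximalPlanar ∧ ∀ k : ThreeClique G, ¬ G.IsSeparating (k.1 : Set V)

end SimpleGraph

/-! Fix a clique `i` with incoming neighbours. Cut off the exterior of `i` and the interior of each
incoming neighbour; what remains of `G` is exactly the union (`unionVerts_eq`). Each part cut off is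
attached to the rest along a triangle only, and cutting along triangles preserves what is needed.

Maximality is a count: a planar graph on n ≥ 3 vertices has at most 3n - 6 edges, with equality
exactly for the maximal planar ones. When a part attached to a triangle is removed,
inclusion-exclusion and the bound for the removed part together with its triangle show that 3n - 6
persists (`ncard_edgesIn_diff`).

For separation, every 3-clique of the union is `i` or an incoming neighbour
(`mem_unionCliques_of_subset`). Removing such a clique and its cut-off part from `G` leaves one side
of it, which is connected (`connectedIn_of_divides`); deleting the other cut-off parts keeps it
connected, since each is attached to a clique (`ConnectedIn.diff`).

The order enters through `below_of_subset`: a clique contained in `i` and its interior is below `i`.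
The connected exterior of `i` lies on one side of that clique, and comparing sizes excludes the
wrong side.

The edge bound needs the Euler inequality and triangular faces. Maps with dangling darts make
cutting or adding an edge a multiplication of the face permutation by a transposition, which changes
the number of cycles by one. In a maximal planar graph any two vertices of a face are adjacent, so a
longer face would carry a K4 with all four vertices on one face. Restricting the map to that K4
keeps them on a face, although all its faces are triangles. -/

/-! ### Merging two classes of an equivalence relation -/

namespace Setoid

variable {α : Type*}

/-- The equivalence relation obtained from `r` by merging the classes of `a` and `b`. -/
def merge (r : Setoid α) (a b : α) : Setoid α where
  r x y := r x y ∨ ((r x a ∨ r x b) ∧ (r y a ∨ r y b))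
  iseqv :=
    { refl := fun x => Or.inl (r.refl x)
      symm := by
        rintro x y (h | ⟨h, h'⟩)
        · exact Or.inl (r.symm h)
        · exact Or.inr ⟨h', h⟩
      trans := by
        rintro x y z (h | ⟨h, h'⟩) (k | ⟨k, k'⟩)
        · exact Or.inl (r.trans h k)
        · exact Or.inr ⟨k.imp (r.trans h) (r.trans h), k'⟩
        · exact Or.inr ⟨h, h'.imp (r.trans (r.symm k)) (r.trans (r.symm k))⟩
        · exact Or.inr ⟨h, k'⟩ }

variable {r s : Setoid α} {a b x y : α}

lemma le_merge : r ≤ r.merge a b := fun {_ _} h => Or.inl h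

lemma merge_pair : r.merge a b a b := Or.inr ⟨Or.inl (r.refl a), Or.inr (r.refl b)⟩

lemma merge_le (h : r ≤ s) (hab : s a b) : r.merge a b ≤ s := by
  rintro x y (k | ⟨k | k, k' | k'⟩)
  · exact h k
  · exact s.trans (h k) (s.symm (h k'))
  · exact s.trans (h k) (s.trans hab (s.symm (h k')))
  · exact s.trans (h k) (s.trans (s.symm hab) (s.symm (h k')))
  · exact s.trans (h k) (s.symm (h k'))

lemma merge_eq_self (h : r a b) : r.merge a b = r :=
  le_antisymm (merge_le le_rfl h) le_merge

lemma card_quotient_merge [Finite α] (h : ¬ r a b) :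
    Nat.card (Quotient (r.merge a b)) + 1 = Nat.card (Quotient r) := by
  classical
  -- The class of `b` is absorbed by that of `a`, so the other classes represent the merged ones
  -- once each.
  have key : Function.Bijective (fun q : {q : Quotient r // q ≠ ⟦b⟧} =>
      Quotient.map' (s₂ := r.merge a b) id (fun _ _ h => le_merge h) q.1) := by
    constructor
    · rintro ⟨p, hp⟩ ⟨q, hq⟩ hpq
      induction p using Quotient.inductionOn
      induction q using Quotient.inductionOn
      rename_i x y
      have hx : ¬ r x b := fun k => hp (Quotient.sound k)
      have hy : ¬ r y b := fun k => hq (Quotient.sound k)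
      have : r.merge a b x y := Quotient.exact hpq
      apply Subtype.ext
      apply Quotient.sound
      rcases this with k | ⟨k, k'⟩
      · exact k
      · exact r.trans (k.resolve_right hx) (r.symm (k'.resolve_right hy))
    · intro q
      induction q using Quotient.inductionOn
      rename_i x
      by_cases hx : r x b
      · refine ⟨⟨⟦a⟧, fun k => h (Quotient.exact k)⟩, Quotient.sound ?_⟩
        exact Or.inr ⟨Or.inl (r.refl a), Or.inr hx⟩
      · exact ⟨⟨⟦x⟧, fun k => hx (Quotient.exact k)⟩, rfl⟩
  rw [← Nat.card_eq_of_bijective _ key]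
  have := Fintype.ofFinite (Quotient r)
  rw [Nat.card_eq_fintype_card, Nat.card_eq_fintype_card, Fintype.card_subtype_compl,
    Fintype.card_subtype_eq]
  have : 0 < Fintype.card (Quotient r) := Fintype.card_pos_iff.2 ⟨⟦a⟧⟩
  omega

end Setoid

/-! ### Counting the cycles of a permutation -/

namespace Equiv.Perm

variable {α β : Type*}

/-- The cycle relation is generated by single steps, so an invariant of cycles need only be checked
on one application of `f`. -/
lemma setoid_le_iff {f : Perm α} {s : Setoid α} :
    SameCycle.setoid f ≤ s ↔ ∀ x, s x (f x) := by
  refine ⟨fun h x => h (show f.SameCycle x (f x) from ⟨1, rfl⟩), fun h x y hxy => ?_⟩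
  obtain ⟨i, rfl⟩ : f.SameCycle x y := hxy
  have hnat : ∀ (n : ℕ) (z : α), s z ((f ^ n) z) := by
    intro n
    induction n with
    | zero => exact fun z => s.refl z
    | succ n ih => exact fun z => s.trans (h z) (by simpa [pow_succ] using ih (f z))
  obtain ⟨n, rfl | rfl⟩ := i.eq_nat_or_neg
  · simpa using hnat n x
  · have := hnat n ((f ^ (-(n : ℤ))) x)
    simpa using s.symm this

lemma SameCycle.rel_of_step {f : Perm α} {s : Setoid α} (h : ∀ x, s x (f x)) {x y : α}
    (hxy : f.SameCycle x y) : s x y :=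
  setoid_le_iff.2 h hxy

lemma sameCycle_apply (f : Perm α) (x : α) : f.SameCycle x (f x) := ⟨1, rfl⟩

/-- The number of cycles of a permutation, fixed points included. -/
noncomputable def numCycles (f : Perm α) : ℕ := Nat.card (Quotient (SameCycle.setoid f))

/-- `g` is the first return of the permutation `f` to the range of `ι`. -/
def IsFirstReturn (f : Perm α) (ι : β → α) (g : Perm β) : Prop :=
  ∀ b, ∃ k, ι (g b) = (f ^ (k + 1)) (ι b) ∧ ∀ j < k, (f ^ (j + 1)) (ι b) ∉ Set.range ι

/-- The cycles of a first return of `f` are the traces of the cycles of `f`. -/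
lemma IsFirstReturn.sameCycle_iff [Finite α] {f : Perm α} {ι : β → α} {g : Perm β}
    (hι : Function.Injective ι) (h : IsFirstReturn f ι g) (x y : β) :
    g.SameCycle x y ↔ f.SameCycle (ι x) (ι y) := by
  constructor
  · refine SameCycle.rel_of_step (s := (SameCycle.setoid f).comap ι) fun b => ?_
    obtain ⟨k, hk, -⟩ := h b
    exact ⟨(k + 1 : ℕ), by rw [zpow_natCast, hk]⟩
  · intro hxy
    obtain ⟨m, hm⟩ := hxy.exists_nat_pow_eq
    induction m using Nat.strong_induction_on generalizing x with
    | _ m ih =>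
      rcases m with _ | m
      · have : x = y := hι (by simpa using hm)
        exact this ▸ SameCycle.refl _ _
      · obtain ⟨k, hk, hk'⟩ := h x
        -- `ι y` is itself a visit to the range after `m + 1` steps, so the first return is no
        -- later.
        have hkm : k ≤ m := by
          by_contra! hlt
          exact hk' m hlt ⟨y, hm.symm⟩
        have hgy : (f ^ (m - k)) (ι (g x)) = ι y := by
          rw [hk, ← mul_apply, ← pow_add, ← hm]
          congr 2
          omega
        exact (g.sameCycle_apply x).trans (ih (m - k) (by omega) (g x) ⟨(m - k : ℕ), by
          rw [zpow_natCast, hgy]⟩ hgy)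

/-- Finite order makes every point return. If two points return to the same place, cancelling the
shorter time from the longer would exhibit an earlier return, unless the times and hence the points
agree. -/
lemma exists_isFirstReturn [Finite α] (f : Perm α) {ι : β → α} (hι : Function.Injective ι) :
    ∃ g : Perm β, IsFirstReturn f ι g := by
  classical
  have : Finite β := Finite.of_injective ι hι
  have hex : ∀ b, ∃ k, (f ^ (k + 1)) (ι b) ∈ Set.range ι := fun b =>
    ⟨orderOf f - 1, b, by rw [Nat.sub_add_cancel (orderOf_pos f), pow_orderOf_eq_one]; rfl⟩
  choose g hg using fun b => Nat.find_spec (hex b)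
  have aux : ∀ x y, g x = g y → Nat.find (hex x) ≤ Nat.find (hex y) → x = y := by
    intro x y hxy hle
    have h1 : (f ^ (Nat.find (hex x) + 1)) (ι x) = (f ^ (Nat.find (hex y) + 1)) (ι y) := by
      rw [← hg, ← hg, hxy]
    have h2 : Nat.find (hex y) + 1 =
        (Nat.find (hex x) + 1) + (Nat.find (hex y) - Nat.find (hex x)) := by omega
    rw [h2, pow_add f (Nat.find (hex x) + 1) (_ - _), mul_apply,
      EmbeddingLike.apply_eq_iff_eq] at h1
    rcases Nat.eq_zero_or_pos (Nat.find (hex y) - Nat.find (hex x)) with h0 | h0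
    · rw [h0] at h1
      exact hι (by simpa using h1)
    · refine absurd ?_ (Nat.find_min (hex y)
        (m := Nat.find (hex y) - Nat.find (hex x) - 1) (by omega))
      rw [Nat.sub_add_cancel h0, ← h1]
      exact ⟨x, rfl⟩
  have hinj : Function.Injective g := fun x y hxy =>
    (le_total (Nat.find (hex x)) (Nat.find (hex y))).elim (aux x y hxy)
      (fun h => (aux y x hxy.symm h).symm)
  refine ⟨Equiv.ofBijective g (Finite.injective_iff_bijective.1 hinj), fun b =>
    ⟨Nat.find (hex b), hg b, fun j hj => Nat.find_min (hex b) hj⟩⟩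

variable [DecidableEq α] {f : Perm α} {a b x y : α}

/-- The two permutations differ only by exchanging the images of `a` and `b`, which is invisible
once these are identified. The statements on cycles being split or joined use this comparison. -/
lemma merge_sameCycle_mul_swap (f : Perm α) (a b : α) :
    (SameCycle.setoid (f * swap a b)).merge a b = (SameCycle.setoid f).merge a b := by
  have key : ∀ g : Perm α, (SameCycle.setoid (g * swap a b)).merge a b ≤
      (SameCycle.setoid g).merge a b := by
    intro g
    refine Setoid.merge_le (setoid_le_iff.2 fun x => ?_) Setoid.merge_pair
    have hstep : ∀ z, (SameCycle.setoid g).merge a b z (g z) :=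
      fun z => Setoid.le_merge (g.sameCycle_apply z)
    by_cases hxa : x = a
    · subst hxa
      simpa using Setoid.trans' _ Setoid.merge_pair (hstep b)
    by_cases hxb : x = b
    · subst hxb
      simpa using Setoid.trans' _ (Setoid.symm' _ Setoid.merge_pair) (hstep a)
    simpa [swap_apply_of_ne_of_ne hxa hxb] using hstep x
  refine le_antisymm (key f) ?_
  -- The transposition is an involution, so the other inclusion is the same statement for `f * swap
  -- a b`.
  simpa [mul_assoc] using key (f * swap a b)

lemma SameCycle.mul_swap_or (hxy : f.SameCycle x y) :
    (f * swap a b).SameCycle x y ∨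
      (((f * swap a b).SameCycle x a ∨ (f * swap a b).SameCycle x b) ∧
        ((f * swap a b).SameCycle y a ∨ (f * swap a b).SameCycle y b)) := by
  have h1 : (SameCycle.setoid f).merge a b x y := Setoid.le_merge hxy
  rwa [← merge_sameCycle_mul_swap] at h1

lemma SameCycle.of_mul_swap (h : f.SameCycle a b) (hxy : (f * swap a b).SameCycle x y) :
    f.SameCycle x y := by
  have h1 : (SameCycle.setoid (f * swap a b)).merge a b x y := Setoid.le_merge hxy
  rwa [merge_sameCycle_mul_swap, Setoid.merge_eq_self (r := SameCycle.setoid f) h] at h1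

variable [Finite α]

/-- From `a` the new permutation jumps to `f b` and then traces the `f`-cycle of `b`, which avoids
`a`, until it reaches `b`. -/
lemma sameCycle_mul_swap_of_not (h : ¬ f.SameCycle a b) : (f * swap a b).SameCycle a b := by
  classical
  have hex : ∃ n, (f ^ (n + 1)) b = b := by
    refine ⟨orderOf f - 1, ?_⟩
    rw [Nat.sub_add_cancel (orderOf_pos f), pow_orderOf_eq_one]
    rfl
  have hmin : ∀ k ≤ Nat.find hex, ((f * swap a b) ^ (k + 1)) a = (f ^ (k + 1)) b := by
    intro k
    induction k with
    | zero => simp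
    | succ k ih =>
      intro hk
      rw [pow_succ', mul_apply, ih (by omega), pow_succ' f (k + 1), mul_apply f, mul_apply,
        swap_apply_of_ne_of_ne]
      · intro h'
        exact h (SameCycle.symm ⟨((k + 1 : ℕ) : ℤ), by rw [zpow_natCast, h']⟩)
      · exact Nat.find_min hex (show k < _ by omega)
  refine ⟨(Nat.find hex + 1 : ℕ), ?_⟩
  rw [zpow_natCast, hmin _ le_rfl]
  exact Nat.find_spec hex

/-- The arc `f a`, ..., `f ^ (k + 1) a = b` with `k` least is closed under the new permutation,
which sends `b` to `f a`. It does not contain `a`: a return to `a` would give an earlier visit to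
`b`. -/
lemma not_sameCycle_mul_swap (hab : a ≠ b) (h : f.SameCycle a b) :
    ¬ (f * swap a b).SameCycle a b := by
  classical
  have hex : ∃ n, (f ^ (n + 1)) a = b := by
    obtain ⟨n, hn⟩ := h.exists_nat_pow_eq
    rcases n with _ | n
    · exact absurd (by simpa using hn) hab
    · exact ⟨n, hn⟩
  set k := Nat.find hex with hk
  have hkb : (f ^ (k + 1)) a = b := Nat.find_spec hex
  have hclosed : ∀ x, (∃ j ≤ k, x = (f ^ (j + 1)) a) →
      ∃ j ≤ k, (f * swap a b) x = (f ^ (j + 1)) a := by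
    rintro x ⟨j, hj, rfl⟩
    rcases hj.eq_or_lt with rfl | hj
    · exact ⟨0, Nat.zero_le _, by simp [hkb]⟩
    · refine ⟨j + 1, hj, ?_⟩
      rw [mul_apply, swap_apply_of_ne_of_ne, ← mul_apply, ← pow_succ']
      · intro ha
        refine Nat.find_min hex (m := k - (j + 1)) (by omega) ?_
        have : k + 1 = (k - (j + 1) + 1) + (j + 1) := by omega
        rw [this, pow_add, mul_apply, ha] at hkb
        exact hkb
      · exact Nat.find_min hex hj
  intro hs
  obtain ⟨m, hm⟩ := hs.symm.exists_nat_pow_eq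
  have hall : ∀ m : ℕ, ∃ j ≤ k, ((f * swap a b) ^ m) b = (f ^ (j + 1)) a := by
    intro m
    induction m with
    | zero => exact ⟨k, le_rfl, by simp [hkb]⟩
    | succ m ih =>
      rw [pow_succ', mul_apply]
      exact hclosed _ ih
  obtain ⟨j, hj, hja⟩ := hall m
  rw [hm] at hja
  rcases hj.eq_or_lt with rfl | hj
  · exact hab (hja.trans hkb)
  · refine Nat.find_min hex (m := k - (j + 1)) (by omega) ?_
    have : k + 1 = (k - (j + 1) + 1) + (j + 1) := by omega
    rw [this, pow_add, mul_apply, ← hja] at hkb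
    exact hkb

lemma numCycles_mul_swap_of_not (h : ¬ f.SameCycle a b) :
    numCycles (f * swap a b) + 1 = numCycles f := by
  have h1 := Setoid.card_quotient_merge (r := SameCycle.setoid f) (a := a) (b := b) h
  rw [← merge_sameCycle_mul_swap,
    Setoid.merge_eq_self (r := SameCycle.setoid (f * swap a b)) (sameCycle_mul_swap_of_not h)] at h1
  exact h1

lemma numCycles_mul_swap (hab : a ≠ b) (h : f.SameCycle a b) :
    numCycles (f * swap a b) = numCycles f + 1 := by
  have := numCycles_mul_swap_of_not (not_sameCycle_mul_swap hab h)
  rw [mul_assoc, swap_mul_self, mul_one] at this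
  exact this.symm

lemma SameCycle.mul_swap_of_not (h : ¬ f.SameCycle a b) (hxy : f.SameCycle x y) :
    (f * swap a b).SameCycle x y := by
  have h1 : (SameCycle.setoid f).merge a b x y := Setoid.le_merge hxy
  rwa [← merge_sameCycle_mul_swap,
    Setoid.merge_eq_self (r := SameCycle.setoid (f * swap a b)) (sameCycle_mul_swap_of_not h)] at h1

end Equiv.Perm

namespace SimpleGraph

variable {V : Type*} {D : Type*} {G G' : SimpleGraph V} {x y : V}

open Equiv Equiv.Perm

/-! ### Adding an edge: connected components and edges -/

lemma reachableSetoid_le_iff {s : Setoid V} :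
    G.reachableSetoid ≤ s ↔ ∀ u v, G.Adj u v → s u v := by
  refine ⟨fun h u v huv => h (show G.Reachable u v from huv.reachable), fun h u v huv => ?_⟩
  obtain ⟨p⟩ : G.Reachable u v := huv
  induction p with
  | nil => exact s.refl _
  | cons hadj _ ih => exact s.trans (h _ _ hadj) ih

lemma reachableSetoid_sup_edge (G : SimpleGraph V) (hxy : x ≠ y) :
    (G ⊔ edge x y).reachableSetoid = G.reachableSetoid.merge x y := by
  apply le_antisymm
  · rw [reachableSetoid_le_iff]
    rintro u v (h | h)
    · exact Setoid.le_merge (show G.Reachable u v from h.reachable)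
    · rw [edge_adj] at h
      rcases h.1 with ⟨rfl, rfl⟩ | ⟨rfl, rfl⟩
      · exact Setoid.merge_pair
      · exact Setoid.symm' _ Setoid.merge_pair
  · refine Setoid.merge_le (fun u v (h : G.Reachable u v) => ?_) ?_
    · exact h.mono le_sup_left
    · refine Adj.reachable (G := G ⊔ edge x y) (Or.inr ?_)
      rw [edge_adj]
      exact ⟨Or.inl ⟨rfl, rfl⟩, hxy⟩

lemma card_connectedComponent_sup_edge_of_reachable (hxy : x ≠ y) (h : G.Reachable x y) :
    Nat.card (G ⊔ edge x y).ConnectedComponent = Nat.card G.ConnectedComponent := by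
  have := reachableSetoid_sup_edge G hxy
  rw [Setoid.merge_eq_self (r := G.reachableSetoid) h] at this
  exact congrArg (fun s => Nat.card (Quotient s)) this

lemma card_connectedComponent_sup_edge [Finite V] (hxy : x ≠ y) (h : ¬ G.Reachable x y) :
    Nat.card (G ⊔ edge x y).ConnectedComponent + 1 = Nat.card G.ConnectedComponent := by
  have h1 := Setoid.card_quotient_merge (r := G.reachableSetoid) (a := x) (b := y) h
  rw [← reachableSetoid_sup_edge G hxy] at h1
  exact h1

lemma card_edgeSet_sup_edge [Finite V] (hxy : x ≠ y) (h : ¬ G.Adj x y) :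
    Nat.card (G ⊔ edge x y).edgeSet = Nat.card G.edgeSet + 1 := by
  classical
  have := Fintype.ofFinite V
  have := G.card_edgeFinset_sup_edge h hxy
  rw [Nat.card_eq_fintype_card, Nat.card_eq_fintype_card, ← edgeFinset_card, ← edgeFinset_card,
    ← this]

/-! ### Maps with dangling darts -/

/-- A combinatorial map with underlying graph `G`. In contrast to a rotation system, there may be
dangling darts, which are the fixed points of `inv`; every vertex carries at least one dart, so
that isolated vertices need no special treatment. -/
structure DartMap (G : SimpleGraph V) (D : Type*) where
  rot : Perm D
  inv : Perm D
  vert : D → V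
  vert_surjective : Function.Surjective vert
  sameCycle_iff : ∀ d e, rot.SameCycle d e ↔ vert d = vert e
  inv_inv : ∀ d, inv (inv d) = d
  adj : ∀ d, inv d ≠ d → G.Adj (vert d) (vert (inv d))
  exists_dart : ∀ x y, G.Adj x y → ∃ d, vert d = x ∧ vert (inv d) = y
  unique : ∀ d e, inv d ≠ d → vert d = vert e → vert (inv d) = vert (inv e) → d = e

namespace DartMap

/-- The face permutation. -/
def face (M : DartMap G D) : Perm D := M.rot * M.inv

/-- The map is drawn on a union of spheres. -/
def IsSpherical (M : DartMap G D) : Prop :=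
  Nat.card V + numCycles M.face = Nat.card G.edgeSet + 2 * Nat.card G.ConnectedComponent

/-- Some face is incident with all vertices of `S`. -/
def OnFace (M : DartMap G D) (S : Set V) : Prop :=
  ∃ d, ∀ v ∈ S, ∃ e, M.vert e = v ∧ M.face.SameCycle d e

lemma face_apply (M : DartMap G D) (d : D) : M.face d = M.rot (M.inv d) := rfl

lemma vert_rot (M : DartMap G D) (d : D) : M.vert (M.rot d) = M.vert d :=
  ((M.sameCycle_iff _ _).1 (M.rot.sameCycle_apply d)).symm

lemma reachable_inv (M : DartMap G D) (d : D) : G.Reachable (M.vert d) (M.vert (M.inv d)) := by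
  by_cases h : M.inv d = d
  · rw [h]
  · exact (M.adj d h).reachable

lemma reachable_of_sameCycle (M : DartMap G D) {d e : D} (h : M.face.SameCycle d e) :
    G.Reachable (M.vert d) (M.vert e) := by
  refine SameCycle.rel_of_step (s := G.reachableSetoid.comap M.vert) (fun d => ?_) h
  change G.Reachable (M.vert d) (M.vert (M.face d))
  rw [face_apply, vert_rot]
  exact M.reachable_inv d

lemma numCycles_rot (M : DartMap G D) : numCycles M.rot = Nat.card V := by
  refine Nat.card_congr (Equiv.ofBijective
    (Quotient.lift M.vert fun d e h => (M.sameCycle_iff d e).1 h) ⟨?_, ?_⟩)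
  · intro p q
    induction p using Quotient.inductionOn
    induction q using Quotient.inductionOn
    exact fun h => Quotient.sound ((M.sameCycle_iff _ _).2 h)
  · intro v
    obtain ⟨d, rfl⟩ := M.vert_surjective v
    exact ⟨⟦d⟧, rfl⟩

lemma deleteEdges_sup_edge (M : DartMap G D) (d : D) (hd : M.inv d ≠ d) :
    G.deleteEdges {s(M.vert d, M.vert (M.inv d))} ⊔ edge (M.vert d) (M.vert (M.inv d)) = G := by
  ext u v
  have := M.adj d hd
  rw [sup_adj, deleteEdges_adj, edge_adj, Set.mem_singleton_iff, Sym2.eq_iff]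
  constructor
  · rintro (h | ⟨⟨rfl, rfl⟩ | ⟨rfl, rfl⟩, -⟩)
    · exact h.1
    · exact this
    · exact this.symm
  · intro h
    have := h.ne
    tauto

variable [DecidableEq D]

/-- Join two dangling darts to an edge. -/
def link (M : DartMap G D) (d e : D) (hd : M.inv d = d) (he : M.inv e = e)
    (hne : M.vert d ≠ M.vert e) (hadj : ¬ G.Adj (M.vert d) (M.vert e)) :
    DartMap (G ⊔ edge (M.vert d) (M.vert e)) D :=
  have hde : d ≠ e := fun h => hne (by rw [h])
  have h1 : (M.inv * swap d e) d = e := by simp [he]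
  have h2 : (M.inv * swap d e) e = d := by simp [hd]
  have h3 : ∀ a, a ≠ d → a ≠ e → (M.inv * swap d e) a = M.inv a := fun a had hae => by
    simp [swap_apply_of_ne_of_ne had hae]
  have hi : ∀ a, a ≠ d → a ≠ e → M.inv a ≠ d ∧ M.inv a ≠ e := fun a had hae =>
    ⟨fun h => had (by rw [← M.inv_inv a, h, hd]), fun h => hae (by rw [← M.inv_inv a, h, he])⟩
  { rot := M.rot
    inv := M.inv * swap d e
    vert := M.vert
    vert_surjective := M.vert_surjective
    sameCycle_iff := M.sameCycle_iff
    inv_inv := by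
      intro a
      by_cases had : a = d
      · rw [had, h1, h2]
      by_cases hae : a = e
      · rw [hae, h2, h1]
      rw [h3 a had hae, h3 _ (hi a had hae).1 (hi a had hae).2, M.inv_inv]
    adj := by
      intro a ha
      by_cases had : a = d
      · rw [had, h1]
        exact Or.inr ((edge_adj ..).2 ⟨Or.inl ⟨rfl, rfl⟩, hne⟩)
      by_cases hae : a = e
      · rw [hae, h2]
        exact Or.inr ((edge_adj ..).2 ⟨Or.inr ⟨rfl, rfl⟩, hne.symm⟩)
      rw [h3 a had hae] at ha ⊢
      exact Or.inl (M.adj a ha)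
    exists_dart := by
      rintro u v (h | h)
      · obtain ⟨a, rfl, rfl⟩ := M.exists_dart u v h
        have had : a ≠ d := by
          rintro rfl
          rw [hd] at h
          exact h.ne rfl
        have hae : a ≠ e := by
          rintro rfl
          rw [he] at h
          exact h.ne rfl
        exact ⟨a, rfl, by rw [h3 a had hae]⟩
      · rcases ((edge_adj ..).1 h).1 with ⟨rfl, rfl⟩ | ⟨rfl, rfl⟩
        · exact ⟨d, rfl, by rw [h1]⟩
        · exact ⟨e, rfl, by rw [h2]⟩
    unique := by
      have aux : ∀ a, a ≠ d → a ≠ e → M.vert a = M.vert d →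
          M.vert ((M.inv * swap d e) a) ≠ M.vert e := by
        intro a had hae h h'
        rw [h3 a had hae] at h'
        have := M.adj a (fun k => hne (by rw [← h, ← h', k]))
        rw [h, h'] at this
        exact hadj this
      have aux' : ∀ a, a ≠ d → a ≠ e → M.vert a = M.vert e →
          M.vert ((M.inv * swap d e) a) ≠ M.vert d := by
        intro a had hae h h'
        rw [h3 a had hae] at h'
        have := M.adj a (fun k => hne (by rw [← h, ← h', k]))
        rw [h, h'] at this
        exact hadj this.symm
      intro a b ha hab hab'
      by_cases had : a = d
      · subst had
        by_contra hb
        by_cases hbe : b = e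
        · exact hne (by rw [hab, hbe])
        · exact aux b (Ne.symm hb) hbe hab.symm (by rw [← hab', h1])
      by_cases hae : a = e
      · subst hae
        by_contra hb
        by_cases hbd : b = d
        · exact hne (by rw [hab, hbd])
        · exact aux' b hbd (Ne.symm hb) hab.symm (by rw [← hab', h2])
      by_cases hbd : b = d
      · subst hbd
        exact absurd (by rw [hab', h1]) (aux a had hae hab)
      by_cases hbe : b = e
      · subst hbe
        exact absurd (by rw [hab', h2]) (aux' a had hae hab)
      rw [h3 a had hae] at ha hab'
      rw [h3 b hbd hbe] at hab'
      exact M.unique a b ha hab hab' }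

/-- Cut the edge of the dart `d` into two dangling darts. -/
def unlink (M : DartMap G D) (d : D) (hd : M.inv d ≠ d) :
    DartMap (G.deleteEdges {s(M.vert d, M.vert (M.inv d))}) D :=
  have h1 : (M.inv * swap d (M.inv d)) d = d := by simp [M.inv_inv]
  have h2 : (M.inv * swap d (M.inv d)) (M.inv d) = M.inv d := by simp
  have h3 : ∀ a, a ≠ d → a ≠ M.inv d → (M.inv * swap d (M.inv d)) a = M.inv a :=
    fun a had hae => by simp [swap_apply_of_ne_of_ne had hae]
  have hi : ∀ a, a ≠ d → a ≠ M.inv d → M.inv a ≠ d ∧ M.inv a ≠ M.inv d := fun a had hae =>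
    ⟨fun h => hae (by rw [← h, M.inv_inv]), fun h => had (M.inv.injective h)⟩
  have hd' : M.inv (M.inv d) ≠ M.inv d := fun h => hd (M.inv.injective h)
  { rot := M.rot
    inv := M.inv * swap d (M.inv d)
    vert := M.vert
    vert_surjective := M.vert_surjective
    sameCycle_iff := M.sameCycle_iff
    inv_inv := by
      intro a
      by_cases had : a = d
      · rw [had, h1, h1]
      by_cases hae : a = M.inv d
      · rw [hae, h2, h2]
      rw [h3 a had hae, h3 _ (hi a had hae).1 (hi a had hae).2, M.inv_inv]
    adj := by
      intro a ha
      by_cases had : a = d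
      · exact absurd h1 (had ▸ ha)
      by_cases hae : a = M.inv d
      · rw [hae] at ha
        exact absurd h2 ha
      rw [h3 a had hae] at ha ⊢
      refine deleteEdges_adj.2 ⟨M.adj a ha, fun h => ?_⟩
      rcases Sym2.eq_iff.1 (Set.mem_singleton_iff.1 h) with ⟨h, h'⟩ | ⟨h, h'⟩
      · exact had (M.unique a d ha h h')
      · exact hae (M.unique a (M.inv d) ha h (by rw [h', M.inv_inv]))
    exists_dart := by
      intro u v h
      obtain ⟨h, h'⟩ := deleteEdges_adj.1 h
      obtain ⟨a, rfl, rfl⟩ := M.exists_dart u v h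
      refine ⟨a, rfl, ?_⟩
      rw [h3]
      · rintro rfl
        exact h' rfl
      · rintro rfl
        exact h' (by rw [M.inv_inv, Sym2.eq_swap]; rfl)
    unique := by
      intro a b ha hab hab'
      have had : a ≠ d := by
        rintro rfl
        exact ha h1
      have hae : a ≠ M.inv d := by
        rintro rfl
        exact ha h2
      rw [h3 a had hae] at ha hab'
      by_cases hbd : b = d
      · subst hbd
        rw [h1] at hab'
        exact absurd (hab.trans hab'.symm) (M.adj a ha).ne
      by_cases hbe : b = M.inv d
      · subst hbe
        rw [h2] at hab'
        exact absurd (hab.trans hab'.symm) (M.adj a ha).ne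
      rw [h3 b hbd hbe] at hab'
      exact M.unique a b ha hab hab' }

/-- This is what dangling darts are for: the dart set and `rot` stay fixed, so the change of faces
is multiplication by one transposition. -/
lemma face_link (M : DartMap G D) (d e : D) (hd he hne hadj) :
    (M.link d e hd he hne hadj).face = M.face * swap d e :=
  (mul_assoc _ _ _).symm

lemma face_unlink (M : DartMap G D) (d : D) (hd) :
    (M.unlink d hd).face = M.face * swap d (M.inv d) :=
  (mul_assoc _ _ _).symm

/-! ### Euler inequality and deletion of edges -/

variable [Finite V] [Finite D]

/-- The effect of cutting an edge on the number of faces. -/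
lemma unlink_counts (M : DartMap G D) (d : D) (hd : M.inv d ≠ d) :
    Nat.card G.edgeSet =
      Nat.card (G.deleteEdges {s(M.vert d, M.vert (M.inv d))}).edgeSet + 1 ∧
    ((¬ M.face.SameCycle d (M.inv d) ∧ numCycles (M.unlink d hd).face + 1 = numCycles M.face ∧
        Nat.card (G.deleteEdges {s(M.vert d, M.vert (M.inv d))}).ConnectedComponent =
          Nat.card G.ConnectedComponent) ∨
      (M.face.SameCycle d (M.inv d) ∧ numCycles (M.unlink d hd).face = numCycles M.face + 1 ∧
        (Nat.card (G.deleteEdges {s(M.vert d, M.vert (M.inv d))}).ConnectedComponent =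
          Nat.card G.ConnectedComponent + 1 ∧
          ¬ (G.deleteEdges {s(M.vert d, M.vert (M.inv d))}).Reachable (M.vert d)
            (M.vert (M.inv d)) ∨
        Nat.card (G.deleteEdges {s(M.vert d, M.vert (M.inv d))}).ConnectedComponent =
          Nat.card G.ConnectedComponent))) := by
  have hne := (M.adj d hd).ne
  have hadj : ¬ (G.deleteEdges {s(M.vert d, M.vert (M.inv d))}).Adj (M.vert d)
      (M.vert (M.inv d)) := by simp
  have hE := card_edgeSet_sup_edge hne hadj
  rw [M.deleteEdges_sup_edge d hd] at hE
  refine ⟨hE, ?_⟩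
  rw [face_unlink]
  by_cases hs : M.face.SameCycle d (M.inv d)
  · refine Or.inr ⟨hs, numCycles_mul_swap (Ne.symm hd) hs, ?_⟩
    by_cases hr : (G.deleteEdges {s(M.vert d, M.vert (M.inv d))}).Reachable (M.vert d)
        (M.vert (M.inv d))
    · have hC := card_connectedComponent_sup_edge_of_reachable hne hr
      rw [M.deleteEdges_sup_edge d hd] at hC
      exact Or.inr hC.symm
    · have hC := card_connectedComponent_sup_edge hne hr
      rw [M.deleteEdges_sup_edge d hd] at hC
      exact Or.inl ⟨hC.symm, hr⟩
  · refine Or.inl ⟨hs, numCycles_mul_swap_of_not hs, ?_⟩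
    -- The two faces beside the edge merge, and the boundary walk of the merged face still joins the
    -- ends of the cut edge.
    have hr := (M.unlink d hd).reachable_of_sameCycle (d := d) (e := M.inv d) (by
      rw [face_unlink]
      exact sameCycle_mul_swap_of_not hs)
    have hC := card_connectedComponent_sup_edge_of_reachable hne hr
    rw [M.deleteEdges_sup_edge d hd] at hC
    exact hC.symm

omit [DecidableEq D] in
/-- The Euler characteristic is at most that of a union of spheres. -/
theorem card_add_numCycles_le (M : DartMap G D) :
    Nat.card V + numCycles M.face ≤ Nat.card G.edgeSet + 2 * Nat.card G.ConnectedComponent := by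
  classical
  induction hn : Nat.card G.edgeSet using Nat.strong_induction_on generalizing G with
  | _ n ih =>
    by_cases h : ∃ d, M.inv d ≠ d
    · obtain ⟨d, hd⟩ := h
      -- In each case of the count, cutting the edge does not increase E + 2C - V - F.
      obtain ⟨hE, hF⟩ := M.unlink_counts d hd
      have := ih _ (by omega) (M.unlink d hd) rfl
      omega
    · push Not at h
      have hinv : M.inv = 1 := Equiv.ext h
      have hbot : G = ⊥ := by
        ext u v
        simp only [bot_adj, iff_false]
        intro huv
        obtain ⟨d, rfl, rfl⟩ := M.exists_dart u v huv
        rw [h] at huv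
        exact huv.ne rfl
      have hc : Nat.card V ≤ Nat.card G.ConnectedComponent := by
        refine Nat.card_le_card_of_injective G.connectedComponentMk fun u v huv => ?_
        obtain ⟨p⟩ := ConnectedComponent.exact huv
        subst hbot
        cases p with
        | nil => rfl
        | cons h _ => exact absurd h (by simp)
      rw [face, hinv, mul_one, numCycles_rot]
      omega

/-- Cutting an edge keeps E + 2C - V - F or lowers it by two. It is zero before the cut and cannot
become negative. -/
lemma IsSpherical.unlink {M : DartMap G D} (hM : M.IsSpherical) (d : D) (hd : M.inv d ≠ d) :
    (M.unlink d hd).IsSpherical := by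
  obtain ⟨hE, hF⟩ := M.unlink_counts d hd
  have := (M.unlink d hd).card_add_numCycles_le
  unfold IsSpherical at *
  omega

/-- If the edge borders two faces, these merge and nothing is lost. If it borders one face, it is a
bridge on the sphere and the face splits into two walks in different components; `S` stays
connected, so it meets only one of them. -/
lemma IsSpherical.onFace_unlink {M : DartMap G D} (hM : M.IsSpherical) (d : D)
    (hd : M.inv d ≠ d) {S : Set V} (hS : M.OnFace S)
    (hconn : ∀ u ∈ S, ∀ v ∈ S,
      (G.deleteEdges {s(M.vert d, M.vert (M.inv d))}).Reachable u v) :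
    (M.unlink d hd).OnFace S := by
  obtain ⟨a, ha⟩ := hS
  have hM' := hM.unlink d hd
  obtain ⟨hE, ⟨hs, -, -⟩ | ⟨hs, hF, h⟩⟩ := M.unlink_counts d hd
  · refine ⟨a, fun v hv => ?_⟩
    obtain ⟨e, he, hae⟩ := ha v hv
    refine ⟨e, he, ?_⟩
    rw [face_unlink]
    exact SameCycle.mul_swap_of_not hs hae
  · have hr : ¬ (G.deleteEdges {s(M.vert d, M.vert (M.inv d))}).Reachable (M.vert d)
        (M.vert (M.inv d)) := by
      unfold IsSpherical at hM hM'
      rcases h with h | h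
      · exact h.2
      · omega
    by_cases hda : M.face.SameCycle d a
    · rcases S.eq_empty_or_nonempty with rfl | ⟨u, hu⟩
      · exact ⟨a, by simp⟩
      have key : ∀ v ∈ S, ∃ e, M.vert e = v ∧ ((M.unlink d hd).face.SameCycle d e ∨
          (M.unlink d hd).face.SameCycle (M.inv d) e) := by
        intro v hv
        obtain ⟨e, he, hae⟩ := ha v hv
        refine ⟨e, he, ?_⟩
        rw [face_unlink]
        rcases SameCycle.mul_swap_or (a := d) (b := M.inv d) (hda.trans hae) with h | h
        · exact Or.inl h
        · exact h.2.imp SameCycle.symm SameCycle.symm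
      obtain ⟨e, rfl, he⟩ := key u hu
      refine ⟨e, fun v hv => ?_⟩
      obtain ⟨e', rfl, he'⟩ := key v hv
      refine ⟨e', rfl, ?_⟩
      have huv := hconn _ hu _ hv
      rcases he with he | he <;> rcases he' with he' | he'
      · exact he.symm.trans he'
      · exact absurd (((M.unlink d hd).reachable_of_sameCycle he).trans (huv.trans
          ((M.unlink d hd).reachable_of_sameCycle he').symm)) hr
      · exact absurd (((M.unlink d hd).reachable_of_sameCycle he').trans (huv.symm.trans
          ((M.unlink d hd).reachable_of_sameCycle he).symm)) hr
      · exact he.symm.trans he'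
    · refine ⟨a, fun v hv => ?_⟩
      obtain ⟨e, he, hae⟩ := ha v hv
      refine ⟨e, he, ?_⟩
      rw [face_unlink]
      refine (SameCycle.mul_swap_or hae).resolve_right fun h' => hda ?_
      rcases h'.1 with h' | h'
      · exact (SameCycle.of_mul_swap hs h').symm
      · exact hs.trans (SameCycle.of_mul_swap hs h').symm

omit [DecidableEq D] in
/-- A spherical map restricts to every spanning subgraph. -/
theorem IsSpherical.exists_of_le {M : DartMap G D} (hM : M.IsSpherical) (hle : G' ≤ G) :
    ∃ M' : DartMap G' D, M'.IsSpherical ∧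
      ∀ S : Set V, (∀ u ∈ S, ∀ v ∈ S, G'.Reachable u v) → M.OnFace S → M'.OnFace S := by
  classical
  induction hn : Nat.card G.edgeSet using Nat.strong_induction_on generalizing G with
  | _ n ih =>
    by_cases h : G' = G
    · subst h
      exact ⟨M, hM, fun S _ h => h⟩
    · obtain ⟨u, v, huv, huv'⟩ : ∃ u v, G.Adj u v ∧ ¬ G'.Adj u v := by
        by_contra! hcon
        exact h (le_antisymm hle hcon)
      obtain ⟨d, rfl, rfl⟩ := M.exists_dart u v huv
      have hd : M.inv d ≠ d := by
        intro hd
        rw [hd] at huv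
        exact huv.ne rfl
      have hle' : G' ≤ G.deleteEdges {s(M.vert d, M.vert (M.inv d))} := by
        intro a b hab
        refine deleteEdges_adj.2 ⟨hle hab, fun h => ?_⟩
        rcases Sym2.eq_iff.1 (Set.mem_singleton_iff.1 h) with ⟨rfl, rfl⟩ | ⟨rfl, rfl⟩
        · exact huv' hab
        · exact huv' hab.symm
      obtain ⟨hE, -⟩ := M.unlink_counts d hd
      obtain ⟨M', hM', hS'⟩ := ih _ (by omega) (hM.unlink d hd) hle' rfl
      exact ⟨M', hM', fun S hS h => hS' S hS (hM.onFace_unlink d hd h fun u hu v hv =>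
        (hS u hu v hv).mono hle')⟩

end DartMap

end SimpleGraph

/-! ### From dart maps to rotation systems -/

namespace SimpleGraph

variable {V : Type*} {D : Type*} {G : SimpleGraph V}

open Equiv Equiv.Perm

namespace DartMap

/-- The dart of the map `M` that corresponds to a dart of the graph. -/
noncomputable def dart (M : DartMap G D) (a : G.Dart) : D :=
  (M.exists_dart a.fst a.snd a.adj).choose

lemma vert_dart (M : DartMap G D) (a : G.Dart) : M.vert (M.dart a) = a.fst :=
  (M.exists_dart a.fst a.snd a.adj).choose_spec.1

lemma vert_inv_dart (M : DartMap G D) (a : G.Dart) : M.vert (M.inv (M.dart a)) = a.snd :=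
  (M.exists_dart a.fst a.snd a.adj).choose_spec.2

lemma inv_ne_of_vert {M : DartMap G D} {d : D} (h : G.Adj (M.vert d) (M.vert (M.inv d))) :
    M.inv d ≠ d := fun hd => h.ne (by rw [hd])

lemma inv_dart_ne (M : DartMap G D) (a : G.Dart) : M.inv (M.dart a) ≠ M.dart a := by
  apply inv_ne_of_vert
  rw [vert_dart, vert_inv_dart]
  exact a.adj

lemma dart_injective (M : DartMap G D) : Function.Injective M.dart := by
  intro a b hab
  apply Dart.ext
  apply Prod.ext
  · rw [← M.vert_dart a, hab, M.vert_dart]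
  · rw [← M.vert_inv_dart a, hab, M.vert_inv_dart]

lemma dart_symm (M : DartMap G D) (a : G.Dart) : M.dart a.symm = M.inv (M.dart a) := by
  apply M.unique _ _ (M.inv_dart_ne _)
  · rw [vert_dart, vert_inv_dart]
    rfl
  · rw [vert_inv_dart, M.inv_inv, vert_dart]
    rfl

lemma mem_range_dart_iff (M : DartMap G D) (d : D) : d ∈ Set.range M.dart ↔ M.inv d ≠ d := by
  constructor
  · rintro ⟨a, rfl⟩
    exact M.inv_dart_ne a
  · intro h
    refine ⟨⟨(M.vert d, M.vert (M.inv d)), M.adj d h⟩, ?_⟩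
    exact M.unique _ _ (M.inv_dart_ne _) (M.vert_dart _) (M.vert_inv_dart _)

/-- A rotation system has the same faces as the map `M`. -/
def SameFaces (M : DartMap G D) (R : RotationSystem G) : Prop :=
  ∀ a b : G.Dart, R.faceStep.SameCycle a b ↔ M.face.SameCycle (M.dart a) (M.dart b)

lemma vert_eq_of_face_sameCycle (M : DartMap G D) {d e : D} (h : ∀ w, ¬ G.Adj (M.vert d) w)
    (hde : M.face.SameCycle d e) : M.vert d = M.vert e := by
  have hr := M.reachable_of_sameCycle hde
  generalize M.vert d = x at h hr
  generalize M.vert e = y at hr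
  obtain ⟨p⟩ := hr
  cases p with
  | nil => rfl
  | cons hadj _ => exact absurd hadj (h _)

variable [Finite D]

/-- Every dart at a vertex that is not isolated shares its face with a dart of the graph at that
vertex. -/
lemma exists_dart_sameCycle (M : DartMap G D) (d : D) (h : ∃ w, G.Adj (M.vert d) w) :
    ∃ a : G.Dart, a.fst = M.vert d ∧ M.face.SameCycle d (M.dart a) := by
  obtain ⟨w, hw⟩ := h
  obtain ⟨e, he, rfl⟩ := M.exists_dart _ _ hw
  have hed : M.rot.SameCycle d e := (M.sameCycle_iff _ _).2 he.symm
  obtain ⟨n, hn⟩ := hed.exists_nat_pow_eq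
  have hdart : ∃ b, M.dart b = e := by
    rw [← Set.mem_range, mem_range_dart_iff]
    exact inv_ne_of_vert (by rw [he]; exact hw)
  clear hw hed
  induction n generalizing d with
  | zero =>
    obtain ⟨b, rfl⟩ := hdart
    refine ⟨b, by rw [← vert_dart M, he], ?_⟩
    rw [← hn]
    rfl
  | succ n ih =>
    -- At a dangling dart the face permutation acts as the rotation, so the face walk follows the
    -- rotation until a dart of the graph is met.
    by_cases hd : M.inv d = d
    · obtain ⟨a, ha, ha'⟩ := ih (M.rot d) (by rw [he, vert_rot])
        (by rw [← hn, pow_succ]; rfl)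
      refine ⟨a, by rw [ha, vert_rot], SameCycle.trans ⟨1, ?_⟩ ha'⟩
      rw [zpow_one, face_apply, hd]
    · obtain ⟨a, rfl⟩ := (M.mem_range_dart_iff d).2 hd
      exact ⟨a, (M.vert_dart a).symm, SameCycle.refl _ _⟩

/-- All darts at an isolated vertex dangle, so there the face permutation is the rotation. -/
lemma face_sameCycle_of_isolated (M : DartMap G D) {d e : D} (h : ∀ w, ¬ G.Adj (M.vert d) w)
    (hde : M.vert d = M.vert e) : M.face.SameCycle d e := by
  obtain ⟨n, hn⟩ := ((M.sameCycle_iff _ _).2 hde).exists_nat_pow_eq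
  clear hde
  induction n generalizing d with
  | zero => exact ⟨0, hn⟩
  | succ n ih =>
    have hd : M.inv d = d := by
      by_contra hd
      exact h _ (M.adj d hd)
    refine SameCycle.trans ⟨1, ?_⟩ (ih (d := M.rot d) (by rwa [vert_rot])
      (by rw [← hn, pow_succ]; rfl))
    rw [zpow_one, face_apply, hd]

/-- A face of `M` either contains a dart of the graph, and is then a cycle of `faceStep`, or
consists of the darts at one isolated vertex. These are the two summands of `numFaces`. -/
theorem SameFaces.numFaces_eq {M : DartMap G D} {R : RotationSystem G} (h : M.SameFaces R) :
    R.numFaces = numCycles M.face := by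
  classical
  have hV : Finite V := Finite.of_surjective _ M.vert_surjective
  have : Finite (Quotient (SameCycle.setoid R.faceStep)) := by
    have : Finite G.Dart := Finite.of_injective _ M.dart_injective
    infer_instance
  unfold RotationSystem.numFaces
  rw [← Nat.card_sum]
  have hf : ∀ a b : G.Dart, SameCycle.setoid R.faceStep a b →
      SameCycle.setoid M.face (M.dart a) (M.dart b) := fun a b => (h a b).1
  choose s hs using M.vert_surjective
  refine Nat.card_congr (Equiv.ofBijective (Sum.elim (Quotient.map M.dart hf)
    (fun v => ⟦s v.1⟧)) ⟨?_, ?_⟩)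
  · refine Function.Injective.sumElim ?_ ?_ ?_
    · intro p q
      induction p using Quotient.inductionOn
      induction q using Quotient.inductionOn
      intro hpq
      exact Quotient.sound ((h _ _).2 (Quotient.exact hpq))
    · intro v w hvw
      have hvw' : M.face.SameCycle (s v.1) (s w.1) := Quotient.exact hvw
      have := M.vert_eq_of_face_sameCycle (by rw [hs]; exact v.2) hvw'
      rw [hs, hs] at this
      exact Subtype.ext this
    · intro p v
      induction p using Quotient.inductionOn
      rename_i a
      intro hav
      have hav' : M.face.SameCycle (M.dart a) (s v.1) := Quotient.exact hav
      have := M.vert_eq_of_face_sameCycle (by rw [hs]; exact v.2) hav'.symm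
      rw [hs, vert_dart] at this
      exact v.2 a.snd (this ▸ a.adj)
  · intro q
    induction q using Quotient.inductionOn
    rename_i d
    by_cases hd : ∃ w, G.Adj (M.vert d) w
    · obtain ⟨a, -, ha⟩ := M.exists_dart_sameCycle d hd
      exact ⟨Sum.inl ⟦a⟧, Quotient.sound ha.symm⟩
    · push Not at hd
      exact ⟨Sum.inr ⟨M.vert d, hd⟩,
        Quotient.sound (M.face_sameCycle_of_isolated (by rwa [hs]) (hs _))⟩

/-- Forgetting the dangling darts yields a rotation system. -/
theorem exists_rotationSystem (M : DartMap G D) : ∃ R : RotationSystem G, M.SameFaces R := by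
  obtain ⟨next, hnext⟩ := exists_isFirstReturn M.rot M.dart_injective
  refine ⟨⟨next, fun a b => ?_⟩, IsFirstReturn.sameCycle_iff M.dart_injective fun a => ?_⟩
  · rw [hnext.sameCycle_iff M.dart_injective, M.sameCycle_iff, vert_dart, vert_dart]
  · obtain ⟨k, hk, hk'⟩ := hnext a.symm
    -- The darts passed before the return dangle, so after its first step the face walk coincides
    -- with the rotation from the reversed dart.
    have hpow : ∀ j ≤ k, (M.face ^ (j + 1)) (M.dart a) = (M.rot ^ (j + 1)) (M.dart a.symm) := by
      intro j
      induction j with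
      | zero =>
        intro _
        rw [zero_add, pow_one, pow_one, face_apply, dart_symm]
      | succ j ih =>
        intro hj
        have hdang := hk' j hj
        rw [mem_range_dart_iff, not_not] at hdang
        rw [pow_succ', mul_apply, ih (by omega), face_apply, hdang, pow_succ' _ (j + 1), mul_apply]
    exact ⟨k, by rw [hpow k le_rfl]; exact hk, fun j hj => by rw [hpow j hj.le]; exact hk' j hj⟩

lemma IsSpherical.isPlanar {M : DartMap G D} (hM : M.IsSpherical) : G.IsPlanar := by
  obtain ⟨R, hR⟩ := M.exists_rotationSystem
  refine ⟨R, ?_⟩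
  unfold RotationSystem.IsSpherical
  rw [hR.numFaces_eq]
  exact hM

end DartMap

/-! ### From rotation systems to dart maps, and adding edges -/

namespace RotationSystem

variable (R : RotationSystem G)

lemma faceStep_apply (a : G.Dart) : R.faceStep a = R.next a.symm := rfl

lemma fst_next (a : G.Dart) : (R.next a).fst = a.fst :=
  ((R.sameCycle_iff _ _).1 (R.next.sameCycle_apply a)).symm

lemma fst_faceStep (a : G.Dart) : (R.faceStep a).fst = a.snd := R.fst_next a.symm

/-- Rotation with one spare dart inserted after every dart. -/
def spareRot : Perm (G.Dart × Bool) where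
  toFun p := if p.2 then (R.next p.1, false) else (p.1, true)
  invFun p := if p.2 then (p.1, false) else (R.next.symm p.1, true)
  left_inv := by rintro ⟨a, _ | _⟩ <;> simp
  right_inv := by rintro ⟨a, _ | _⟩ <;> simp

/-- Reversal of darts that fixes the spare darts. -/
def spareInv : Perm (G.Dart × Bool) :=
  Function.Involutive.toPerm (fun p => if p.2 then p else (p.1.symm, false)) (by
    rintro ⟨a, _ | _⟩ <;> simp)

@[simp] lemma spareInv_false (a : G.Dart) : spareInv (a, false) = (a.symm, false) := rfl
@[simp] lemma spareInv_true (a : G.Dart) : spareInv (a, true) = (a, true) := rfl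

/-- The map of a rotation system, with a spare dangling dart in every corner and at every isolated
vertex. -/
def toDartMap : DartMap G (G.Dart × Bool ⊕ {v : V // ∀ w, ¬ G.Adj v w}) where
  rot := Perm.sumCongr R.spareRot 1
  inv := Perm.sumCongr spareInv 1
  vert := Sum.elim (fun p => p.1.fst) Subtype.val
  vert_surjective := by
    intro v
    by_cases h : ∃ w, G.Adj v w
    · obtain ⟨w, hw⟩ := h
      exact ⟨Sum.inl (⟨(v, w), hw⟩, false), rfl⟩
    · push Not at h
      exact ⟨Sum.inr ⟨v, h⟩, rfl⟩
  sameCycle_iff := by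
    intro d e
    constructor
    · refine SameCycle.rel_of_step (s := Setoid.ker _) ?_
      rintro (⟨a, _ | _⟩ | v)
      · rfl
      · exact (R.fst_next a).symm
      · rfl
    · have hstep := (Perm.sumCongr R.spareRot (1 : Perm {v : V // ∀ w, ¬ G.Adj v w})).sameCycle_apply
      have h1 : ∀ a b : G.Dart, a.fst = b.fst →
          (Perm.sumCongr R.spareRot (1 : Perm {v : V // ∀ w, ¬ G.Adj v w})).SameCycle
            (Sum.inl (a, false)) (Sum.inl (b, false)) := by
        intro a b hab
        refine SameCycle.rel_of_step (s := (SameCycle.setoid _).comap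
          (fun a : G.Dart => (Sum.inl (a, false) : G.Dart × Bool ⊕ {v : V // ∀ w, ¬ G.Adj v w})))
          (fun a => ?_) ((R.sameCycle_iff a b).2 hab)
        exact (hstep (Sum.inl (a, false))).trans (hstep (Sum.inl (a, true)))
      have h2 : ∀ (a : G.Dart) (b : Bool),
          (Perm.sumCongr R.spareRot (1 : Perm {v : V // ∀ w, ¬ G.Adj v w})).SameCycle
            (Sum.inl (a, false)) (Sum.inl (a, b)) := by
        rintro a (_ | _)
        · exact SameCycle.refl _ _
        · exact hstep _
      rcases d with ⟨a, i⟩ | v <;> rcases e with ⟨b, j⟩ | w <;> intro h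
      · exact (h2 a i).symm.trans ((h1 a b h).trans (h2 b j))
      · exact absurd a.adj (by rw [show a.fst = w.1 from h]; exact w.2 _)
      · exact absurd b.adj (by rw [← show v.1 = b.fst from h]; exact v.2 _)
      · rw [Subtype.ext (show v.1 = w.1 from h)]
  inv_inv := by rintro (⟨a, _ | _⟩ | v) <;> simp
  adj := by
    rintro (⟨a, _ | _⟩ | v) h
    · exact a.adj
    · simp at h
    · simp at h
  exists_dart := fun x y h => ⟨Sum.inl (⟨(x, y), h⟩, false), rfl, rfl⟩
  unique := by
    rintro (⟨a, _ | _⟩ | v) (⟨b, _ | _⟩ | w) h h1 h2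
    · have : a = b := Dart.ext _ _ (Prod.ext h1 h2)
      rw [this]
    · exact absurd (h2.trans h1.symm) a.fst_ne_snd.symm
    · exact absurd a.adj (by rw [show a.fst = w.1 from h1]; exact w.2 _)
    all_goals simp at h

lemma dart_toDartMap (a : G.Dart) : R.toDartMap.dart a = Sum.inl (a, false) := by
  refine R.toDartMap.unique _ _ (R.toDartMap.inv_dart_ne a) ?_ ?_
  · rw [DartMap.vert_dart]
    rfl
  · rw [DartMap.vert_inv_dart]
    rfl

lemma toDartMap_face_false (a : G.Dart) :
    R.toDartMap.face (Sum.inl (a, false)) = Sum.inl (a.symm, true) := rfl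

lemma toDartMap_face_true (a : G.Dart) :
    R.toDartMap.face (Sum.inl (a, true)) = Sum.inl (R.next a, false) := rfl

lemma sameFaces_toDartMap : R.toDartMap.SameFaces R := by
  intro a b
  rw [dart_toDartMap, dart_toDartMap]
  constructor
  · intro hab
    refine SameCycle.rel_of_step (s := (SameCycle.setoid R.toDartMap.face).comap
      (fun a : G.Dart => Sum.inl (a, false))) (fun a => ?_) hab
    exact (R.toDartMap.face.sameCycle_apply (Sum.inl (a, false))).trans
      (R.toDartMap.face.sameCycle_apply (Sum.inl (a.symm, true)))
  · intro hab
    let q : G.Dart × Bool ⊕ {v : V // ∀ w, ¬ G.Adj v w} →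
        Option (Quotient (SameCycle.setoid R.faceStep)) :=
      -- The spare dart after `a` lies on the face walk between `a.symm` and `R.faceStep a.symm`, so
      -- it is assigned to the face of `a.symm`.
      Sum.elim (fun p => some ⟦if p.2 then p.1.symm else p.1⟧) (fun _ => none)
    have : q (Sum.inl (a, false)) = q (Sum.inl (b, false)) := by
      refine SameCycle.rel_of_step (s := Setoid.ker q) ?_ hab
      rintro (⟨a, _ | _⟩ | v)
      · rw [toDartMap_face_false]
        simp [q, Setoid.ker_def]
      · rw [toDartMap_face_true]
        simp only [q, Setoid.ker_def, Sum.elim_inl]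
        refine congrArg some (Quotient.sound ?_)
        exact R.faceStep.sameCycle_apply a.symm
      · rfl
    exact Quotient.exact (Option.some_injective _ this)

/-- The spare dart preceding `a` lies on the same face as `a`. -/
lemma exists_spare (a : G.Dart) : ∃ d, R.toDartMap.inv d = d ∧ R.toDartMap.vert d = a.fst ∧
    R.toDartMap.face.SameCycle d (R.toDartMap.dart a) := by
  refine ⟨Sum.inl (R.next.symm a, true), rfl, ?_, ?_⟩
  · change (R.next.symm a).fst = a.fst
    rw [← R.fst_next, apply_symm_apply]
  · refine ⟨1, ?_⟩
    rw [zpow_one, toDartMap_face_true, apply_symm_apply, dart_toDartMap]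

lemma exists_spare_of_vertex (v : V) :
    ∃ d, R.toDartMap.inv d = d ∧ R.toDartMap.vert d = v := by
  by_cases h : ∃ w, G.Adj v w
  · obtain ⟨w, hw⟩ := h
    obtain ⟨d, hd, hv, -⟩ := R.exists_spare ⟨(v, w), hw⟩
    exact ⟨d, hd, hv⟩
  · push Not at h
    exact ⟨Sum.inr ⟨v, h⟩, rfl, rfl⟩

variable {R} [Finite V]

instance finite_dart : Finite G.Dart := Finite.of_injective _ Dart.toProd_injective

lemma IsSpherical.toDartMap (hR : R.IsSpherical) : R.toDartMap.IsSpherical := by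
  unfold DartMap.IsSpherical
  rw [← R.sameFaces_toDartMap.numFaces_eq]
  exact hR

/-- Two components of a planar graph can be joined by an edge. -/
theorem IsSpherical.isPlanar_sup_edge_of_not_reachable (hR : R.IsSpherical) {x y : V}
    (h : ¬ G.Reachable x y) : (G ⊔ edge x y).IsPlanar := by
  classical
  obtain ⟨d, hd, rfl⟩ := R.exists_spare_of_vertex x
  obtain ⟨e, he, rfl⟩ := R.exists_spare_of_vertex y
  have hne : R.toDartMap.vert d ≠ R.toDartMap.vert e := fun h' => h (by rw [h'])
  have hadj : ¬ G.Adj (R.toDartMap.vert d) (R.toDartMap.vert e) := fun h' => h h'.reachable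
  apply DartMap.IsSpherical.isPlanar (M := R.toDartMap.link d e hd he hne hadj)
  have hs : ¬ R.toDartMap.face.SameCycle d e :=
    fun h' => h (R.toDartMap.reachable_of_sameCycle h')
  -- One face fewer, one edge more, one component fewer: Euler's formula persists.
  have h1 := numCycles_mul_swap_of_not hs
  have h2 := card_edgeSet_sup_edge hne hadj
  have h3 := card_connectedComponent_sup_edge hne h
  have h4 := hR.toDartMap
  unfold DartMap.IsSpherical at h4 ⊢
  rw [DartMap.face_link]
  omega

/-- Two nonadjacent vertices on a common face can be joined by an edge. -/
theorem IsSpherical.isPlanar_sup_edge (hR : R.IsSpherical) {a b : G.Dart}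
    (hab : R.faceStep.SameCycle a b) (hne : a.fst ≠ b.fst) (hadj : ¬ G.Adj a.fst b.fst) :
    (G ⊔ edge a.fst b.fst).IsPlanar := by
  classical
  obtain ⟨d, hd, hda, hd'⟩ := R.exists_spare a
  obtain ⟨e, he, heb, he'⟩ := R.exists_spare b
  rw [← hda, ← heb] at hne hadj ⊢
  apply DartMap.IsSpherical.isPlanar (M := R.toDartMap.link d e hd he hne hadj)
  have hs : R.toDartMap.face.SameCycle d e :=
    hd'.trans (((R.sameFaces_toDartMap a b).1 hab).trans he'.symm)
  -- The new edge splits a face, so faces and edges both increase by one.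
  have h1 := numCycles_mul_swap (fun h => hne (by rw [h])) hs
  have h2 := card_edgeSet_sup_edge hne hadj
  have h3 := card_connectedComponent_sup_edge_of_reachable hne
    (R.toDartMap.reachable_of_sameCycle hs)
  have h4 := hR.toDartMap
  unfold DartMap.IsSpherical at h4 ⊢
  rw [DartMap.face_link]
  omega

end RotationSystem

end SimpleGraph

/-! ### Permutations whose cycles have length at least three -/

namespace Equiv.Perm

variable {α : Type*} [Fintype α] {f : Perm α}

lemma card_eq_sum_card_cycles [DecidableEq α] (f : Perm α)
    [Fintype (Quotient (SameCycle.setoid f))] [DecidableEq (Quotient (SameCycle.setoid f))] :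
    Fintype.card α = ∑ q : Quotient (SameCycle.setoid f),
      (Finset.univ.filter fun a => (⟦a⟧ : Quotient (SameCycle.setoid f)) = q).card :=
  Finset.card_eq_sum_card_fiberwise fun _ _ => Finset.mem_univ _

/-- Each cycle contains the three distinct points `a`, `f a`, `f (f a)`, and a fourth if `f (f (f
a)) ≠ a`. Summing cycle lengths gives all three claims; applied to faces, it is the count 3F ≤ 2E.
-/
lemma three_mul_numCycles_le (h1 : ∀ a, f a ≠ a) (h2 : ∀ a, f (f a) ≠ a) :
    3 * numCycles f ≤ Fintype.card α ∧
      ((∃ a, f (f (f a)) ≠ a) → 3 * numCycles f < Fintype.card α) ∧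
      ((∀ a, f (f (f a)) = a) → 3 * numCycles f = Fintype.card α) := by
  classical
  have hsum := card_eq_sum_card_cycles f
  have hmem : ∀ a : α, ∀ n : ℕ, (⟦(f ^ n) a⟧ : Quotient (SameCycle.setoid f)) = ⟦a⟧ :=
    fun a n => Quotient.sound (SameCycle.symm (⟨n, by simp⟩ : f.SameCycle a ((f ^ n) a)))
  have hm1 : ∀ a, (⟦f a⟧ : Quotient (SameCycle.setoid f)) = ⟦a⟧ := fun a => hmem a 1
  have hm2 : ∀ a, (⟦f (f a)⟧ : Quotient (SameCycle.setoid f)) = ⟦a⟧ := fun a => hmem a 2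
  have hm3 : ∀ a, (⟦f (f (f a))⟧ : Quotient (SameCycle.setoid f)) = ⟦a⟧ := fun a => hmem a 3
  have hcard3 : ∀ a, ({a, f a, f (f a)} : Finset α).card = 3 := fun a =>
    Finset.card_eq_three.2 ⟨_, _, _, (h1 a).symm, (h2 a).symm, (h1 (f a)).symm, rfl⟩
  have hle : ∀ q ∈ (Finset.univ : Finset (Quotient (SameCycle.setoid f))),
      3 ≤ (Finset.univ.filter fun a => (⟦a⟧ : Quotient (SameCycle.setoid f)) = q).card := by
    intro q _
    obtain ⟨a, rfl⟩ := Quotient.exists_rep q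
    rw [← hcard3 a]
    refine Finset.card_le_card fun x hx => ?_
    simp only [Finset.mem_insert, Finset.mem_singleton] at hx
    rw [Finset.mem_filter]
    refine ⟨Finset.mem_univ _, ?_⟩
    rcases hx with rfl | rfl | rfl
    · rfl
    · exact hm1 a
    · exact hm2 a
  have hz : 3 * numCycles f = ∑ _q : Quotient (SameCycle.setoid f), 3 := by
    simp [numCycles, mul_comm]
  rw [hz, hsum]
  refine ⟨Finset.sum_le_sum hle, ?_, ?_⟩
  · rintro ⟨a, ha⟩
    refine Finset.sum_lt_sum hle ⟨⟦a⟧, Finset.mem_univ _, ?_⟩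
    have h4 : ({f (f (f a)), a, f a, f (f a)} : Finset α).card = 4 := by
      rw [Finset.card_insert_of_notMem, hcard3]
      simp only [Finset.mem_insert, Finset.mem_singleton, not_or]
      exact ⟨ha, h2 _, h1 _⟩
    refine lt_of_lt_of_le (by norm_num) (h4.symm.le.trans (Finset.card_le_card fun x hx => ?_))
    simp only [Finset.mem_insert, Finset.mem_singleton] at hx
    rw [Finset.mem_filter]
    refine ⟨Finset.mem_univ _, ?_⟩
    rcases hx with rfl | rfl | rfl | rfl
    · exact hm3 a
    · rfl
    · exact hm1 a
    · exact hm2 a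
  · intro h3
    refine Finset.sum_congr rfl fun q _ => ?_
    obtain ⟨a, rfl⟩ := Quotient.exists_rep q
    rw [← hcard3 a]
    congr 1
    ext x
    simp only [Finset.mem_insert, Finset.mem_singleton, Finset.mem_filter, Finset.mem_univ,
      true_and]
    constructor
    · rintro (rfl | rfl | rfl)
      · rfl
      · exact hm1 a
      · exact hm2 a
    · intro hx
      obtain ⟨n, rfl⟩ := (SameCycle.symm (Quotient.exact hx : f.SameCycle x a)).exists_nat_pow_eq
      clear hx
      induction n with
      | zero => simp
      | succ n ih =>
        rw [pow_succ', mul_apply]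
        rcases ih with h | h | h <;> rw [h] <;> simp [h3]

end Equiv.Perm

namespace SimpleGraph

universe v

variable {V : Type*} {D : Type v} {G H : SimpleGraph V}

open Equiv Equiv.Perm

/-! ### Induced subgraphs of planar graphs -/

namespace DartMap

/-- The restriction of a map to a set of vertices outside which there are no edges. -/
def induce (M : DartMap H D) (U : Set V) (hU : ∀ x y, H.Adj x y → x ∈ U) :
    DartMap (H.induce U) {d // M.vert d ∈ U} :=
  have hinv : ∀ d, M.vert (M.inv d) ∈ U ↔ M.vert d ∈ U := by
    intro d
    by_cases hd : M.inv d = d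
    · rw [hd]
    · exact iff_of_true (hU _ _ (M.adj d hd).symm) (hU _ _ (M.adj d hd))
  { rot := M.rot.subtypePerm fun d => by rw [vert_rot]
    inv := M.inv.subtypePerm hinv
    vert := fun d => ⟨M.vert d.1, d.2⟩
    vert_surjective := by
      rintro ⟨v, hv⟩
      obtain ⟨d, rfl⟩ := M.vert_surjective v
      exact ⟨⟨d, hv⟩, rfl⟩
    sameCycle_iff := by
      intro d e
      rw [sameCycle_subtypePerm, M.sameCycle_iff, Subtype.mk.injEq]
    inv_inv := fun d => Subtype.ext (M.inv_inv d.1)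
    adj := fun d hd => M.adj d.1 fun h => hd (Subtype.ext h)
    exists_dart := by
      rintro ⟨x, hx⟩ ⟨y, hy⟩ h
      obtain ⟨d, rfl, rfl⟩ := M.exists_dart x y h
      exact ⟨⟨d, hx⟩, rfl, rfl⟩
    unique := fun d e hd h1 h2 => Subtype.ext
      (M.unique d.1 e.1 (fun h => hd (Subtype.ext h)) (Subtype.ext_iff.1 h1) (Subtype.ext_iff.1 h2)) }

lemma induce_face_sameCycle (M : DartMap H D) (U : Set V) (hU : ∀ x y, H.Adj x y → x ∈ U)
    (d e : {d // M.vert d ∈ U}) :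
    (M.induce U hU).face.SameCycle d e ↔ M.face.SameCycle d.1 e.1 := by
  have hf : ∀ d, M.vert (M.face d) ∈ U ↔ M.vert d ∈ U := by
    intro d
    rw [face_apply, vert_rot]
    by_cases hd : M.inv d = d
    · rw [hd]
    · exact iff_of_true (hU _ _ (M.adj d hd).symm) (hU _ _ (M.adj d hd))
  have : (M.induce U hU).face = M.face.subtypePerm hf := by
    ext d
    rfl
  rw [this, sameCycle_subtypePerm]

variable [Finite V] [Finite D]

/-- The vertices outside `U` are isolated. Dropping them loses at least as many components and at
most as many faces as vertices; this gives one half of Euler's formula, and the Euler inequality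
gives the other. -/
theorem IsSpherical.induce {M : DartMap H D} (hM : M.IsSpherical) (U : Set V)
    (hU : ∀ x y, H.Adj x y → x ∈ U) : (M.induce U hU).IsSpherical := by
  classical
  have := Fintype.ofFinite V
  have hV : Nat.card V = Nat.card U + Nat.card (Uᶜ : Set V) := by
    rw [← Nat.card_sum]
    exact Nat.card_congr (Equiv.Set.sumCompl U).symm
  have hE : Nat.card (H.induce U).edgeSet = Nat.card H.edgeSet := by
    rw [Nat.card_eq_fintype_card, Nat.card_eq_fintype_card, ← edgeFinset_card, ← edgeFinset_card]
    exact H.card_edgeFinset_induce_of_support_subset fun x ⟨y, hxy⟩ => hU x y hxy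
  have hC : Nat.card (H.induce U).ConnectedComponent + Nat.card (Uᶜ : Set V) ≤
      Nat.card H.ConnectedComponent := by
    rw [← Nat.card_sum]
    let q : V → (H.induce U).ConnectedComponent ⊕ (Uᶜ : Set V) := fun v =>
      if hv : v ∈ U then Sum.inl ((H.induce U).connectedComponentMk ⟨v, hv⟩) else Sum.inr ⟨v, hv⟩
    have hq : H.reachableSetoid ≤ Setoid.ker q := by
      rw [reachableSetoid_le_iff]
      intro u v huv
      have hu := hU _ _ huv
      have hv := hU _ _ huv.symm
      simp only [Setoid.ker_def, q, hu, hv, dif_pos]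
      refine congrArg _ (ConnectedComponent.sound (Adj.reachable ?_))
      exact huv
    refine Nat.card_le_card_of_surjective
      (Quotient.lift q hq : Quotient H.reachableSetoid → _) ?_
    rintro (c | ⟨v, hv⟩)
    · induction c using ConnectedComponent.ind
      rename_i v
      exact ⟨H.connectedComponentMk v.1, dif_pos v.2⟩
    · exact ⟨H.connectedComponentMk v, dif_neg hv⟩
  have hF : numCycles M.face ≤ numCycles (M.induce U hU).face + Nat.card (Uᶜ : Set V) := by
    unfold numCycles
    rw [← Nat.card_sum]
    choose s hs using M.vert_surjective
    refine Nat.card_le_card_of_surjective (Sum.elim (Quotient.map Subtype.val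
      fun d e h => (M.induce_face_sameCycle U hU d e).1 h) fun v => ⟦s v.1⟧) ?_
    intro q
    induction q using Quotient.inductionOn
    rename_i d
    by_cases hd : M.vert d ∈ U
    · exact ⟨Sum.inl ⟦⟨d, hd⟩⟧, rfl⟩
    · exact ⟨Sum.inr ⟨M.vert d, hd⟩, Quotient.sound (M.face_sameCycle_of_isolated
        (fun w hw => hd (hU _ _ (by rwa [hs] at hw))) (hs _))⟩
  have := (M.induce U hU).card_add_numCycles_le
  unfold IsSpherical at *
  omega

end DartMap

lemma mem_of_spanningCoe_adj {U : Set V} (x y : V) (h : (G.induce U).spanningCoe.Adj x y) :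
    x ∈ U := by
  simp only [spanningCoe, map_adj] at h
  obtain ⟨a, b, h, rfl, rfl⟩ := h
  exact a.2

namespace RotationSystem

/-- The hypothesis says that the rotation fixes `a.symm`, so the end of `a` is a leaf. -/
lemma eq_symm_of_faceStep_eq_symm {R : RotationSystem G} {a b : G.Dart}
    (ha : R.faceStep a = a.symm) (hb : b.fst = a.snd) : b = a.symm := by
  have h1 : R.next.SameCycle a.symm b := (R.sameCycle_iff _ _).2 hb.symm
  have h2 : R.next a.symm = a.symm := ha
  exact (h1.eq_of_left h2).symm

lemma faceStep_eq_symm {R : RotationSystem G} {a : G.Dart}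
    (h : (R.faceStep (R.faceStep a)).fst = a.fst) : R.faceStep a = a.symm := by
  apply Dart.ext
  apply Prod.ext
  · exact R.fst_faceStep a
  · rw [← R.fst_faceStep (R.faceStep a), h]
    rfl

/-- A face of length two has leaves at both ends, so its edge would be the whole connected graph. -/
lemma faceStep_faceStep_ne {R : RotationSystem G} (hc : G.Preconnected) (hn : 3 ≤ Nat.card V)
    (a : G.Dart) : R.faceStep (R.faceStep a) ≠ a := by
  classical
  intro h
  have h1 : R.faceStep a = a.symm := faceStep_eq_symm (by rw [h])
  have h2 : R.faceStep a.symm = a.symm.symm := by rw [← h1, h, h1, Dart.symm_symm]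
  let s : Setoid V := Setoid.ker fun v => (v = a.fst ∨ v = a.snd)
  have hs : G.reachableSetoid ≤ s := by
    rw [reachableSetoid_le_iff]
    have aux : ∀ u v, G.Adj u v → (u = a.fst ∨ u = a.snd) → (v = a.fst ∨ v = a.snd) := by
      rintro u v huv (rfl | rfl)
      · have := eq_symm_of_faceStep_eq_symm (b := ⟨(_, v), huv⟩) h2 rfl
        rw [Dart.symm_symm] at this
        exact Or.inr (congrArg (fun d => d.toProd.2) this)
      · have := eq_symm_of_faceStep_eq_symm (b := ⟨(_, v), huv⟩) h1 rfl
        exact Or.inl (congrArg (fun d => d.toProd.2) this)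
    exact fun u v huv => propext ⟨aux u v huv, aux v u huv.symm⟩
  have hall : ∀ v, v ∈ ({a.fst, a.snd} : Set V) := by
    intro v
    have : (a.fst = a.fst ∨ a.fst = a.snd) = (v = a.fst ∨ v = a.snd) := hs (hc a.fst v)
    exact this.mp (Or.inl rfl)
  have h3 := Set.ncard_univ V
  rw [← Set.eq_univ_of_forall hall, Set.ncard_pair a.fst_ne_snd] at h3
  omega

end RotationSystem

variable [Finite V]

/-- A map on the sphere restricts to every induced subgraph, and the vertices of a clique that are
on a common face stay on a common face. -/
theorem DartMap.IsSpherical.exists_induce [Finite D] {M : DartMap G D} (hM : M.IsSpherical)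
    (U : Set V) : ∃ (D' : Type v) (_ : Finite D') (M' : DartMap (G.induce U) D'),
      M'.IsSpherical ∧ (G.IsClique U → U.Nonempty → M.OnFace U → M'.OnFace Set.univ) := by
  obtain ⟨M', hM', hface⟩ := hM.exists_of_le (G.spanningCoe_induce_le U)
  have hM'' := hM'.induce U mem_of_spanningCoe_adj
  have hface' : G.IsClique U → U.Nonempty → M.OnFace U →
      (M'.induce U mem_of_spanningCoe_adj).OnFace Set.univ := by
    rintro hU ⟨u, hu⟩ h
    obtain ⟨d, hd⟩ := hface U (fun v hv w hw => by
      by_cases hvw : v = w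
      · rw [hvw]
      · refine Adj.reachable ?_
        rw [spanningCoe, map_adj]
        exact ⟨⟨v, hv⟩, ⟨w, hw⟩, hU hv hw hvw, rfl, rfl⟩) h
    obtain ⟨e, rfl, he⟩ := hd u hu
    refine ⟨⟨e, hu⟩, fun v _ => ?_⟩
    obtain ⟨e', he', hde'⟩ := hd v.1 v.2
    exact ⟨⟨e', he' ▸ v.2⟩, Subtype.ext he',
      (M'.induce_face_sameCycle U _ _ _).2 (he.symm.trans hde')⟩
  -- The underlying graph is `G.induce U` only up to a propositional equality; generalizing the map
  -- allows rewriting its type.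
  revert hM'' hface'
  generalize M'.induce U mem_of_spanningCoe_adj = M''
  revert M''
  rw [induce_spanningCoe]
  exact fun M'' h1 h2 => ⟨_, inferInstance, M'', h1, h2⟩

theorem IsPlanar.induce (hG : G.IsPlanar) (U : Set V) : (G.induce U).IsPlanar := by
  obtain ⟨R, hR⟩ := hG
  obtain ⟨D', _, M', hM', -⟩ := hR.toDartMap.exists_induce U
  exact hM'.isPlanar

/-! ### The number of edges of a planar graph -/

namespace RotationSystem

/-- Every face has at least three darts, so 3F ≤ 2E, with equality exactly when all faces are
triangles; substitute in V + F = E + 2. -/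
theorem IsSpherical.card_edgeSet_of_connected {R : RotationSystem G} (hR : R.IsSpherical)
    (hc : G.Preconnected) (hn : 3 ≤ Nat.card V) :
    Nat.card G.edgeSet + 6 ≤ 3 * Nat.card V ∧
      (Nat.card G.edgeSet + 6 = 3 * Nat.card V ↔
        ∀ a, R.faceStep (R.faceStep (R.faceStep a)) = a) := by
  classical
  have := Fintype.ofFinite V
  have : Nonempty V := by
    by_contra h
    rw [not_nonempty_iff] at h
    simp at hn
  obtain ⟨h1, h2, h3⟩ := three_mul_numCycles_le (f := R.faceStep)
    (fun a h => a.fst_ne_snd (by rw [← R.fst_faceStep a, h])) (faceStep_faceStep_ne hc hn)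
  rw [G.dart_card_eq_twice_card_edges] at h1 h2 h3
  have hE : Nat.card G.edgeSet = G.edgeFinset.card := by
    rw [Nat.card_eq_fintype_card, edgeFinset_card]
  have hC : Nat.card G.ConnectedComponent = 1 := by
    rw [Nat.card_eq_one_iff_unique]
    exact ⟨hc.subsingleton_connectedComponent, inferInstance⟩
  have hiso : Nat.card {v : V // ∀ w, ¬ G.Adj v w} = 0 := by
    rw [Nat.card_eq_zero]
    left
    refine ⟨fun ⟨v, hv⟩ => ?_⟩
    have : Nontrivial V := by
      rw [← Finite.one_lt_card_iff_nontrivial]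
      omega
    obtain ⟨w, hw⟩ := hc.exists_adj_of_nontrivial v
    exact hv w hw
  unfold IsSpherical numFaces at hR
  rw [hiso, hC] at hR
  change Nat.card V + (numCycles R.faceStep + 0) = _ at hR
  refine ⟨by omega, fun h => ?_, fun h => ?_⟩
  · by_contra! hcon
    have := h2 hcon
    omega
  · have := h3 h
    omega

/-- No face is incident with four pairwise adjacent vertices. -/
theorem IsSpherical.not_isNClique_four {R : RotationSystem G} (hR : R.IsSpherical) {S : Finset V}
    (hS : G.IsNClique 4 S) (a : G.Dart) :
    ¬ ∀ v ∈ S, ∃ b : G.Dart, b.fst = v ∧ R.faceStep.SameCycle a b := by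
  classical
  intro h
  have hcard : Nat.card (S : Set V) = 4 := by
    rw [Nat.card_coe_set_eq, Set.ncard_coe_finset, hS.card_eq]
  have htop : G.induce (S : Set V) = ⊤ := by
    ext x y
    rw [top_adj]
    exact ⟨fun h => h.ne, fun h => hS.isClique x.2 y.2 (fun h' => h (Subtype.ext h'))⟩
  obtain ⟨D', _, M, hM, hface⟩ := hR.toDartMap.exists_induce (S : Set V)
  obtain ⟨R', hR'⟩ := M.exists_rotationSystem
  have hs : R'.IsSpherical := by
    unfold RotationSystem.IsSpherical
    rw [hR'.numFaces_eq]
    exact hM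
  have hc : (G.induce (S : Set V)).Preconnected := by
    rw [htop]
    exact preconnected_top
  have hE : Nat.card (G.induce (S : Set V)).edgeSet = 6 := by
    rw [Nat.card_eq_fintype_card] at hcard
    rw [htop, Nat.card_eq_fintype_card, ← edgeFinset_card, card_edgeFinset_top_eq_card_choose_two,
      hcard]
    rfl
  -- K4 has 6 = 3 · 4 - 6 edges, so all its faces are triangles, and none can meet four vertices.
  have hcube := (hs.card_edgeSet_of_connected hc (by omega)).2.1 (by omega)
  have hne : (S : Set V).Nonempty := by
    rw [← Set.ncard_pos, Set.ncard_coe_finset, hS.card_eq]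
    norm_num
  obtain ⟨d, hd⟩ := hface hS.isClique hne ⟨R.toDartMap.dart a, fun v hv => by
    obtain ⟨b, rfl, hab⟩ := h v hv
    exact ⟨R.toDartMap.dart b, R.toDartMap.vert_dart b, (R.sameFaces_toDartMap a b).1 hab⟩⟩
  have key : ∀ v, ∃ b : (G.induce (S : Set V)).Dart, b.fst = v ∧
      M.face.SameCycle d (M.dart b) := by
    intro v
    have : Nontrivial (S : Set V) := by
      rw [← Finite.one_lt_card_iff_nontrivial]
      omega
    obtain ⟨e, rfl, he⟩ := hd v trivial
    obtain ⟨b, hb, hb'⟩ := M.exists_dart_sameCycle e (hc.exists_adj_of_nontrivial _)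
    exact ⟨b, hb, he.trans hb'⟩
  obtain ⟨u, hu⟩ := hne
  obtain ⟨b, -, hb⟩ := key ⟨u, hu⟩
  have hall : ∀ v, v ∈ ({b.fst, (R'.faceStep b).fst, (R'.faceStep (R'.faceStep b)).fst} :
      Set (S : Set V)) := by
    intro v
    obtain ⟨c, rfl, hdc⟩ := key v
    obtain ⟨n, rfl⟩ := ((hR' b c).2 (hb.symm.trans hdc)).exists_nat_pow_eq
    clear hdc
    have : (R'.faceStep ^ n) b ∈
        ({b, R'.faceStep b, R'.faceStep (R'.faceStep b)} : Set (G.induce (S : Set V)).Dart) := by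
      induction n with
      | zero => simp
      | succ n ih =>
        rw [pow_succ', mul_apply]
        rcases ih with h | h | h <;> rw [h] <;> simp [hcube]
    rcases this with h | h | h <;> rw [h] <;> simp
  have h3 := Set.ncard_univ (S : Set V)
  rw [← Set.eq_univ_of_forall hall, hcard] at h3
  have := Set.ncard_insert_le b.fst {(R'.faceStep b).fst, (R'.faceStep (R'.faceStep b)).fst}
  have := Set.ncard_insert_le (R'.faceStep b).fst {(R'.faceStep (R'.faceStep b)).fst}
  rw [Set.ncard_singleton] at this
  omega

end RotationSystem

/-! ### Maximal planar graphs are triangulations -/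

theorem IsMaximalPlanar.preconnected (hG : G.IsMaximalPlanar) : G.Preconnected := by
  intro x y
  by_contra h
  obtain ⟨R, hR⟩ := hG.prop
  have := hG.le_of_ge (hR.isPlanar_sup_edge_of_not_reachable h) le_sup_left
  refine h (Adj.reachable (this (Or.inr ?_)))
  rw [edge_adj]
  exact ⟨Or.inl ⟨rfl, rfl⟩, fun h' => h (by rw [h'])⟩

lemma IsMaximalPlanar.adj_of_sameCycle (hG : G.IsMaximalPlanar) {R : RotationSystem G}
    (hR : R.IsSpherical) {a b : G.Dart} (hab : R.faceStep.SameCycle a b) (hne : a.fst ≠ b.fst) :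
    G.Adj a.fst b.fst := by
  by_contra h
  have := hG.le_of_ge (hR.isPlanar_sup_edge hab hne h) le_sup_left
  refine h (this (Or.inr ?_))
  rw [edge_adj]
  exact ⟨Or.inl ⟨rfl, rfl⟩, hne⟩

/-- Distinct vertices of a face are adjacent, by maximality. A face that is not a triangle would
have four distinct vertices, which `not_isNClique_four` forbids. -/
theorem IsMaximalPlanar.faceStep_cube (hG : G.IsMaximalPlanar) (hn : 3 ≤ Nat.card V)
    {R : RotationSystem G} (hR : R.IsSpherical) (a : G.Dart) :
    R.faceStep (R.faceStep (R.faceStep a)) = a := by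
  classical
  have hc := hG.preconnected
  have hpow : ∀ a : G.Dart, ∀ n : ℕ, R.faceStep.SameCycle a ((R.faceStep ^ n) a) :=
    fun a n => ⟨n, by simp⟩
  have hs1 : ∀ a : G.Dart, R.faceStep.SameCycle a (R.faceStep a) := fun a => hpow a 1
  have hs2 : ∀ a : G.Dart, R.faceStep.SameCycle a (R.faceStep (R.faceStep a)) :=
    fun a => hpow a 2
  have hs3 : ∀ a : G.Dart, R.faceStep.SameCycle a (R.faceStep (R.faceStep (R.faceStep a))) :=
    fun a => hpow a 3
  have h1 : ∀ a : G.Dart, a.fst ≠ (R.faceStep a).fst := fun a => by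
    rw [R.fst_faceStep]
    exact a.fst_ne_snd
  have h2 : ∀ a : G.Dart, a.fst ≠ (R.faceStep (R.faceStep a)).fst := by
    intro a h
    -- Returning after two steps makes the end of `a` a leaf. The vertex after the return differs
    -- from that end and so is adjacent to it, hence is its only neighbour `a.fst`, from which the
    -- walk has just come.
    have hleaf := RotationSystem.faceStep_eq_symm h.symm
    have hb : (R.faceStep (R.faceStep (R.faceStep a))).fst ≠ a.snd := by
      intro hb
      refine RotationSystem.faceStep_faceStep_ne hc hn a (Dart.ext _ _ (Prod.ext h.symm ?_))
      rw [← hb, R.fst_faceStep (R.faceStep (R.faceStep a))]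
    rw [← R.fst_faceStep a] at hb
    have hadj := hG.adj_of_sameCycle hR (hs2 (R.faceStep a)) hb.symm
    have := RotationSystem.eq_symm_of_faceStep_eq_symm 
      (b := ⟨((R.faceStep a).fst, (R.faceStep (R.faceStep (R.faceStep a))).fst), hadj⟩) hleaf
      (R.fst_faceStep a)
    have h' : (R.faceStep (R.faceStep (R.faceStep a))).fst = a.fst := congrArg (fun d => d.toProd.2) this
    exact h1 (R.faceStep (R.faceStep a)) (h.symm.trans h'.symm)
  by_contra h
  have key : ∀ b c d e : G.Dart, R.faceStep.SameCycle b c → R.faceStep.SameCycle b d →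
      R.faceStep.SameCycle b e → b.fst ≠ c.fst → b.fst ≠ d.fst → b.fst ≠ e.fst → c.fst ≠ d.fst →
      c.fst ≠ e.fst → d.fst ≠ e.fst → False := by
    intro b c d e hc hd he hbc hbd hbe hcd hce hde
    refine hR.not_isNClique_four (S := {b.fst, c.fst, d.fst, e.fst}) ?_ b ?_
    · have h1 := hG.adj_of_sameCycle hR hc hbc
      have h2 := hG.adj_of_sameCycle hR hd hbd
      have h3 := hG.adj_of_sameCycle hR he hbe
      have h4 := hG.adj_of_sameCycle hR (hc.symm.trans hd) hcd
      have h5 := hG.adj_of_sameCycle hR (hc.symm.trans he) hce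
      have h6 := hG.adj_of_sameCycle hR (hd.symm.trans he) hde
      refine IsNClique.insert (is3Clique_triple_iff.2 ⟨h4, h5, h6⟩) ?_
      simp [h1, h2, h3]
    · simp only [Finset.mem_insert, Finset.mem_singleton]
      rintro v (rfl | rfl | rfl | rfl)
      · exact ⟨b, rfl, SameCycle.refl _ _⟩
      · exact ⟨c, rfl, hc⟩
      · exact ⟨d, rfl, hd⟩
      · exact ⟨e, rfl, he⟩
  -- If the fourth vertex of the walk equals the first, the fifth serves instead: it differs from
  -- the second, since otherwise the walk would have closed up after three steps.
  by_cases h3 : a.fst = (R.faceStep (R.faceStep (R.faceStep a))).fst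
  · refine key a (R.faceStep a) (R.faceStep (R.faceStep a))
      (R.faceStep (R.faceStep (R.faceStep (R.faceStep a)))) (hs1 a) (hs2 a)
      ((hs3 a).trans (hs1 _)) (h1 a) (h2 a) ?_ (h1 _) ?_ (h2 _)
    · rw [h3]
      exact h1 _
    · intro h4
      refine h (Dart.ext _ _ (Prod.ext h3.symm ?_))
      rw [← R.fst_faceStep, ← h4, R.fst_faceStep]
  · exact key a (R.faceStep a) (R.faceStep (R.faceStep a))
      (R.faceStep (R.faceStep (R.faceStep a))) (hs1 a) (hs2 a)
      (hs3 a) (h1 a) (h2 a) h3 (h1 _) (h2 _) (h1 _)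

theorem IsMaximalPlanar.card_edgeSet (hG : G.IsMaximalPlanar) (hn : 3 ≤ Nat.card V) :
    Nat.card G.edgeSet + 6 = 3 * Nat.card V := by
  obtain ⟨R, hR⟩ := hG.prop
  exact (hR.card_edgeSet_of_connected hG.preconnected hn).2.2 (hG.faceStep_cube hn hR)

lemma card_edgeSet_mono (h : G ≤ H) : Nat.card G.edgeSet ≤ Nat.card H.edgeSet :=
  Nat.card_mono (Set.toFinite _) (edgeSet_mono h)

/-- A planar graph, connected or not, extends to a maximal planar one on the same vertices, where
the count is exact. -/
theorem IsPlanar.card_edgeSet_le (hG : G.IsPlanar) (hn : 3 ≤ Nat.card V) :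
    Nat.card G.edgeSet + 6 ≤ 3 * Nat.card V := by
  have : Finite (SimpleGraph V) := by
    classical
    have := Fintype.ofFinite V
    infer_instance
  obtain ⟨G', hle, hG'⟩ := (Set.toFinite {G : SimpleGraph V | G.IsPlanar}).exists_le_maximal hG
  rw [← IsMaximalPlanar.card_edgeSet hG' hn]
  exact Nat.add_le_add_right (card_edgeSet_mono hle) 6

theorem IsPlanar.isMaximalPlanar (hG : G.IsPlanar) (hn : 3 ≤ Nat.card V)
    (hE : 3 * Nat.card V ≤ Nat.card G.edgeSet + 6) : G.IsMaximalPlanar := by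
  refine ⟨hG, fun G' hG' hle => ?_⟩
  have h1 := hG'.card_edgeSet_le hn
  have h2 : G.edgeSet = G'.edgeSet := Set.eq_of_subset_of_ncard_le (edgeSet_mono hle)
    (by rw [← Nat.card_coe_set_eq, ← Nat.card_coe_set_eq]; omega) (Set.toFinite _)
  exact (edgeSet_inj.1 h2).symm.le

end SimpleGraph

namespace SimpleGraph

variable {V : Type*} {G : SimpleGraph V}

/-! ### Parts divided by a set of vertices -/

/-- All edges leaving `A` end in `C`. -/
def BoundaryIn (G : SimpleGraph V) (A C : Set V) : Prop :=
  ∀ a ∈ A, ∀ x, G.Adj a x → x ∉ A → x ∈ C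

/-- `X` does not split into two nonempty parts without edges between them. -/
def ConnectedIn (G : SimpleGraph V) (X : Set V) : Prop :=
  ∀ A ⊆ X, A.Nonempty → (X \ A).Nonempty → ∃ a ∈ A, ∃ b ∈ X \ A, G.Adj a b

/-- If `X \ A` split, each piece would need an edge into `A` and hence a vertex of `C`. Two such
vertices are adjacent, because `C` is a clique. -/
lemma ConnectedIn.diff {X A C : Set V} (hX : G.ConnectedIn X) (hC : G.IsClique C)
    (hA : G.BoundaryIn A C) : G.ConnectedIn (X \ A) := by
  intro S hS hne hne'
  by_contra! hcon
  have key : ∀ T ⊆ X \ A, T.Nonempty → ((X \ A) \ T).Nonempty →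
      (∀ a ∈ T, ∀ b ∈ (X \ A) \ T, ¬ G.Adj a b) → ∃ x ∈ T, x ∈ C := by
    intro T hT hTne hTne' hno
    obtain ⟨a, ha, b, hb, hadj⟩ := hX T (fun x hx => (hT hx).1) hTne
      (hTne'.mono fun x hx => ⟨hx.1.1, hx.2⟩)
    refine ⟨a, ha, ?_⟩
    have hbA : b ∈ A := by
      by_contra hbA
      exact hno a ha b ⟨⟨hb.1, hbA⟩, hb.2⟩ hadj
    exact hA b hbA a hadj.symm (hT ha).2
  obtain ⟨x, hx, hxC⟩ := key S hS hne hne' hcon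
  have hself : (X \ A) \ ((X \ A) \ S) = S := by
    rw [Set.sdiff_sdiff_cancel_left hS]
  obtain ⟨y, hy, hyC⟩ := key ((X \ A) \ S) Set.sdiff_subset hne' (by rwa [hself]) (by
    rw [hself]
    exact fun a ha b hb h => hcon b hb a ha h.symm)
  exact hcon x hx y hy (hC hxC hyC (fun h => hy.2 (h ▸ hx)))

lemma ConnectedIn.diff_biUnion {ι : Type*} {X : Set V} (hX : G.ConnectedIn X) (J : Finset ι)
    {B C : ι → Set V} (hC : ∀ k ∈ J, G.IsClique (C k)) (hB : ∀ k ∈ J, G.BoundaryIn (B k) (C k)) :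
    G.ConnectedIn (X \ ⋃ k ∈ J, B k) := by
  classical
  induction J using Finset.induction_on with
  | empty => simpa using hX
  | insert a s _ ih =>
    rw [Finset.set_biUnion_insert, Set.union_comm, ← Set.sdiff_sdiff]
    refine ConnectedIn.diff (ih (fun k hk => hC k (Finset.mem_insert_of_mem hk))
      (fun k hk => hB k (Finset.mem_insert_of_mem hk))) (hC a (Finset.mem_insert_self _ _))
      (hB a (Finset.mem_insert_self _ _))

namespace Divides

variable {C S S' : Set V}

lemma symm (h : G.Divides C S S') : G.Divides C S' S where
  disjoint := h.disjoint.symm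
  union_eq := by rw [Set.union_comm, h.union_eq]
  meets := fun i hi j hj p => by
    obtain ⟨v, hv, hvC⟩ := h.meets j hj i hi p.reverse
    exact ⟨v, by simpa using hv, hvC⟩

lemma disjoint_left (h : G.Divides C S S') : Disjoint S C :=
  Set.disjoint_left.2 fun x hx => by
    have : x ∈ Cᶜ := h.union_eq ▸ Or.inl hx
    exact this

lemma disjoint_right (h : G.Divides C S S') : Disjoint S' C := h.symm.disjoint_left

lemma mem_or (h : G.Divides C S S') {x : V} (hx : x ∉ C) : x ∈ S ∨ x ∈ S' := by
  have : x ∈ S ∪ S' := by rw [h.union_eq]; exact hx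
  exact this

lemma not_adj (h : G.Divides C S S') {x y : V} (hx : x ∈ S) (hy : y ∈ S') : ¬ G.Adj x y := by
  intro hadj
  obtain ⟨v, hv, hvC⟩ := h.meets x hx y hy hadj.toWalk
  simp only [Walk.support_cons, Walk.support_nil, List.mem_cons, List.not_mem_nil,
    or_false] at hv
  rcases hv with rfl | rfl
  · exact Set.disjoint_left.1 h.disjoint_left hx hvC
  · exact Set.disjoint_left.1 h.disjoint_right hy hvC

lemma boundaryIn (h : G.Divides C S S') : G.BoundaryIn S C := by
  intro a ha x hadj hx
  by_contra hxC
  exact h.not_adj ha ((h.mem_or hxC).resolve_left hx) hadj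

lemma of_not_adj (hd : Disjoint S S') (hu : S ∪ S' = Cᶜ)
    (hadj : ∀ x ∈ S, ∀ y ∈ S', ¬ G.Adj x y) : G.Divides C S S' where
  disjoint := hd
  union_eq := hu
  meets := by
    intro i hi j hj p
    induction p with
    | nil => exact absurd hj (Set.disjoint_left.1 hd hi)
    | @cons u v w h p ih =>
      by_cases hv : v ∈ C
      · exact ⟨v, by simp, hv⟩
      · have : v ∈ S ∪ S' := by rw [hu]; exact hv
        rcases this with hv | hv
        · obtain ⟨x, hx, hxC⟩ := ih hv hj
          exact ⟨x, by simp [hx], hxC⟩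
        · exact absurd h (hadj _ hi _ hv)

end Divides

lemma connectedIn_compl {C : Set V} (h : ¬ G.IsSeparating C) : G.ConnectedIn Cᶜ := by
  intro A hA hne hne'
  by_contra! hcon
  exact h ⟨A, Cᶜ \ A, Divides.of_not_adj Set.disjoint_sdiff_right
    (Set.union_sdiff_cancel hA) hcon, hne, hne'⟩

/-! ### Counting edges inside sets of vertices -/

/-- The edges of `G` with both ends in `W`. -/
def edgesIn (G : SimpleGraph V) (W : Set V) : Set (Sym2 V) :=
  {e | e ∈ G.edgeSet ∧ ∀ v ∈ e, v ∈ W}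

lemma card_edgeSet_induce (G : SimpleGraph V) (W : Set V) :
    Nat.card (G.induce W).edgeSet = (G.edgesIn W).ncard := by
  have : G.edgesIn W = Sym2.map Subtype.val '' (G.induce W).edgeSet := by
    ext e
    induction e using Sym2.ind with
    | _ x y =>
      constructor
      · rintro ⟨h, h'⟩
        exact ⟨s(⟨x, h' x (Sym2.mem_mk_left _ _)⟩, ⟨y, h' y (Sym2.mem_mk_right _ _)⟩), h, rfl⟩
      · rintro ⟨e, he, heq⟩
        induction e using Sym2.ind with
        | _ a b =>
          rw [← heq]
          refine ⟨he, ?_⟩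
          rw [Sym2.map_mk]
          intro v hv
          rcases Sym2.mem_iff.1 hv with rfl | rfl
          · exact a.2
          · exact b.2
  rw [this, Set.ncard_image_of_injective _ (Sym2.map.injective Subtype.val_injective),
    Nat.card_coe_set_eq]

variable [Finite V]

/-- No edge joins the two differences, so every edge within the union lies in `X` or in `Y`, and
inclusion-exclusion applies. -/
lemma ncard_edgesIn_union {X Y : Set V} (h : ∀ x ∈ X, x ∉ Y → ∀ y ∈ Y, y ∉ X → ¬ G.Adj x y) :
    (G.edgesIn (X ∪ Y)).ncard + (G.edgesIn (X ∩ Y)).ncard =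
      (G.edgesIn X).ncard + (G.edgesIn Y).ncard := by
  have h1 : G.edgesIn (X ∪ Y) = G.edgesIn X ∪ G.edgesIn Y := by
    ext e
    induction e using Sym2.ind with
    | _ x y =>
      have h1 := h x
      have h2 := h y
      have h3 := G.adj_comm x y
      simp only [edgesIn, Set.mem_union, Set.mem_ofPred_eq, mem_edgeSet, Sym2.mem_iff,
        forall_eq_or_imp, forall_eq]
      by_cases x ∈ X <;> by_cases x ∈ Y <;> by_cases y ∈ X <;> by_cases y ∈ Y <;>
        simp_all
  have h2 : G.edgesIn (X ∩ Y) = G.edgesIn X ∩ G.edgesIn Y := by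
    ext e
    simp only [edgesIn, Set.mem_inter_iff, Set.mem_ofPred_eq]
    exact ⟨fun h => ⟨⟨h.1, fun v hv => (h.2 v hv).1⟩, h.1, fun v hv => (h.2 v hv).2⟩,
      fun h => ⟨h.1.1, fun v hv => ⟨h.1.2 v hv, h.2.2 v hv⟩⟩⟩
  rw [h1, h2, Set.ncard_union_add_ncard_inter]

lemma IsPlanar.ncard_edgesIn_le (hG : G.IsPlanar) {W : Set V} (hW : 3 ≤ W.ncard) :
    (G.edgesIn W).ncard + 6 ≤ 3 * W.ncard := by
  rw [← card_edgeSet_induce, ← Nat.card_coe_set_eq]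
  exact (hG.induce W).card_edgeSet_le (by rwa [Nat.card_coe_set_eq])

lemma IsNClique.ncard_edgesIn {k : Finset V} (hk : G.IsNClique 3 k) :
    (G.edgesIn (k : Set V)).ncard = 3 := by
  classical
  have htop : G.induce (k : Set V) = ⊤ := by
    ext x y
    rw [top_adj]
    exact ⟨fun h => h.ne, fun h => hk.isClique x.2 y.2 (fun h' => h (Subtype.ext h'))⟩
  have := Fintype.ofFinite V
  rw [← card_edgeSet_induce, htop, Nat.card_eq_fintype_card, ← edgeFinset_card,
    card_edgeFinset_top_eq_card_choose_two, ← Nat.card_eq_fintype_card, Nat.card_coe_set_eq,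
    Set.ncard_coe_finset, hk.card_eq]
  rfl

lemma IsNClique.three_le_card {k : Finset V} (hk : G.IsNClique 3 k) : 3 ≤ Nat.card V := by
  rw [← hk.card_eq, ← Set.ncard_coe_finset, ← Set.ncard_univ]
  exact Set.ncard_le_ncard (Set.subset_univ _)

lemma IsNClique.three_le_ncard {k : Finset V} (hk : G.IsNClique 3 k) {W : Set V}
    (h : (k : Set V) ⊆ W) : 3 ≤ W.ncard := by
  rw [← hk.card_eq, ← Set.ncard_coe_finset]
  exact Set.ncard_le_ncard h

lemma IsMaximalPlanar.ncard_edgesIn_univ (hG : G.IsMaximalPlanar) (hn : 3 ≤ Nat.card V) :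
    (G.edgesIn Set.univ).ncard + 6 = 3 * Nat.card V := by
  rw [← hG.card_edgeSet hn, Nat.card_coe_set_eq]
  congr 2
  ext e
  simp [edgesIn]

/-- Removing a part that is attached to a 3-clique preserves the property of having as many edges
as a triangulation. -/
lemma IsPlanar.ncard_edgesIn_diff (hG : G.IsPlanar) {k : Finset V} (hk : G.IsNClique 3 k)
    {W A : Set V} (hW : 3 * W.ncard ≤ (G.edgesIn W).ncard + 6) (hkW : (k : Set V) ⊆ W)
    (hkA : Disjoint A (k : Set V)) (hA : G.BoundaryIn A (k : Set V)) :
    3 * (W \ A).ncard ≤ (G.edgesIn (W \ A)).ncard + 6 := by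
  have hunion : (W \ A) ∪ ((W ∩ A) ∪ (k : Set V)) = W := by
    ext x
    have : x ∈ (k : Set V) → x ∈ W := fun h => hkW h
    simp only [Set.mem_union, Set.mem_sdiff, Set.mem_inter_iff]
    tauto
  have hinter : (W \ A) ∩ ((W ∩ A) ∪ (k : Set V)) = k := by
    ext x
    have : x ∈ (k : Set V) → x ∈ W := fun h => hkW h
    have : x ∈ A → x ∉ (k : Set V) := fun h => Set.disjoint_left.1 hkA h
    simp only [Set.mem_union, Set.mem_sdiff, Set.mem_inter_iff]
    tauto
  have h1 := ncard_edgesIn_union (G := G) (X := W \ A) (Y := (W ∩ A) ∪ (k : Set V)) (by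
    rintro x ⟨hxW, hxA⟩ hxY y hyY hyX hadj
    have hxk : x ∉ (k : Set V) := fun h => hxY (Or.inr h)
    have hyA : y ∈ A := by
      by_contra hyA
      rcases hyY with h | h
      · exact hyA h.2
      · exact hyX ⟨hkW h, hyA⟩
    exact hxk (hA y hyA x hadj.symm hxA))
  have h2 := Set.ncard_union_add_ncard_inter (W \ A) ((W ∩ A) ∪ (k : Set V))
  rw [hunion, hinter] at h1 h2
  rw [hk.ncard_edgesIn] at h1
  rw [Set.ncard_coe_finset, hk.card_eq] at h2
  -- `W` is glued from two pieces along a triangle with exactly 3 · 3 - 6 edges. The bound for the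
  -- piece containing `W ∩ A` leaves at least 3n - 6 edges for the other.
  have h3 := hG.ncard_edgesIn_le (hk.three_le_ncard
    (Set.subset_union_right (s := W ∩ A) (t := (k : Set V))))
  omega

/-- A maximal planar graph has no vertex cut inside an edge. -/
lemma IsMaximalPlanar.exists_adj (hG : G.IsMaximalPlanar) {k : Finset V} (hk : G.IsNClique 3 k)
    {A : Set V} (hA : A.Nonempty) (hkA : Disjoint A (k : Set V))
    (hb : G.BoundaryIn A (k : Set V)) {v : V} (hv : v ∈ k) : ∃ a ∈ A, G.Adj v a := by
  classical
  by_contra! hcon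
  obtain ⟨b, c, hbc, hk'⟩ : ∃ b c, b ≠ c ∧ k.erase v = {b, c} := by
    rw [← Finset.card_eq_two, Finset.card_erase_of_mem hv, hk.card_eq]
  have hmem : ∀ x, x ∈ (k : Set V) ∧ x ≠ v ↔ x ∈ ({b, c} : Set V) := by
    intro x
    have := Finset.ext_iff.1 hk' x
    simp only [Finset.mem_erase, Finset.mem_insert, Finset.mem_singleton] at this
    simp only [Finset.mem_coe, Set.mem_insert_iff, Set.mem_singleton_iff]
    tauto
  have hdisj : ∀ x ∈ ({b, c} : Set V), x ∉ A := fun x hx h =>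
    Set.disjoint_left.1 hkA h ((hmem x).2 hx).1
  -- Without a neighbour of `v`, the part `A` is attached only to the edge `b c`. Gluing two planar
  -- pieces along an edge yields at most 3(n + 2) - 12 - 1 = 3n - 7 edges.
  have hunion : Aᶜ ∪ (A ∪ {b, c}) = Set.univ := by
    rw [← Set.union_assoc, Set.compl_union_self, Set.univ_union]
  have hinter : Aᶜ ∩ (A ∪ {b, c}) = {b, c} := by
    ext x
    have := hdisj x
    rw [Set.mem_inter_iff, Set.mem_compl_iff, Set.mem_union]
    exact ⟨fun h => h.2.resolve_left h.1, fun h => ⟨this h, Or.inr h⟩⟩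
  have h1 := ncard_edgesIn_union (G := G) (X := Aᶜ) (Y := A ∪ {b, c}) (by
    intro x hxA hxY y _ hyA hadj
    rw [Set.mem_compl_iff, not_not] at hyA
    refine hxY (Or.inr ((hmem x).1 ⟨hb y hyA x hadj.symm hxA, ?_⟩))
    rintro rfl
    exact hcon y hyA hadj)
  have h2 := Set.ncard_union_add_ncard_inter Aᶜ (A ∪ {b, c})
  rw [hunion, hinter] at h1 h2
  rw [Set.ncard_pair hbc, Set.ncard_univ] at h2
  have h3 := hG.prop.ncard_edgesIn_le (hk.three_le_ncard (W := Aᶜ)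
    (fun x hx h => Set.disjoint_left.1 hkA h hx))
  have h4 : 3 ≤ (A ∪ {b, c}).ncard := by
    rw [Set.ncard_union_eq (Set.disjoint_left.2 fun x hx h => hdisj x h hx),
      Set.ncard_pair hbc]
    have := (Set.ncard_pos).2 hA
    omega
  have h5 := hG.prop.ncard_edgesIn_le h4
  have h6 := hG.ncard_edgesIn_univ hk.three_le_card
  have h7 : 0 < (G.edgesIn {b, c}).ncard := by
    rw [Set.ncard_pos]
    refine ⟨s(b, c), ?_, fun x hx => ?_⟩
    · exact hk.isClique ((hmem b).2 (by simp)).1 ((hmem c).2 (by simp)).1 hbc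
    · simpa using hx
  omega

/-! ### Links of vertices in maximal planar graphs -/

/-- The corner between consecutive darts belongs to a triangular face, whose third side is this
edge. -/
lemma IsMaximalPlanar.adj_snd_next (hG : G.IsMaximalPlanar) (hn : 3 ≤ Nat.card V)
    {R : RotationSystem G} (hR : R.IsSpherical) (d : G.Dart) : G.Adj d.snd (R.next d).snd := by
  have h := hG.faceStep_cube hn hR d.symm
  have h1 : R.faceStep d.symm = R.next d := by rw [R.faceStep_apply, Dart.symm_symm]
  have h2 := (R.faceStep (R.faceStep d.symm)).adj
  rw [← R.fst_faceStep, h, R.fst_faceStep, h1] at h2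
  exact h2.symm

lemma IsMaximalPlanar.exists_threeClique (hG : G.IsMaximalPlanar) (hn : 3 ≤ Nat.card V) (v : V) :
    ∃ k : Finset V, G.IsNClique 3 k ∧ v ∈ k := by
  classical
  have : Nontrivial V := by
    rw [← Finite.one_lt_card_iff_nontrivial]
    omega
  obtain ⟨R, hR⟩ := hG.prop
  obtain ⟨w, hw⟩ := hG.preconnected.exists_adj_of_nontrivial v
  let d : G.Dart := ⟨(v, w), hw⟩
  have h1 : (R.next d).fst = v := R.fst_next d
  have h2 := (R.next d).adj
  rw [h1] at h2
  exact ⟨{v, w, (R.next d).snd}, is3Clique_triple_iff.2 ⟨hw, h2, hG.adj_snd_next hn hR d⟩,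
    by simp⟩

/-- Going around a vertex of a 3-clique `k`, one leaves a part attached to `k` through `k`. -/
lemma IsMaximalPlanar.exists_dart_next_mem (hG : G.IsMaximalPlanar) {k : Finset V}
    (hk : G.IsNClique 3 k) {R : RotationSystem G} (hR : R.IsSpherical) {A B : Set V}
    (hA : A.Nonempty) (hkA : Disjoint A (k : Set V)) (hbA : G.BoundaryIn A (k : Set V))
    (hB : B.Nonempty) (hkB : Disjoint B (k : Set V)) (hbB : G.BoundaryIn B (k : Set V))
    (hAB : Disjoint A B) {v : V} (hv : v ∈ k) :
    ∃ d : G.Dart, d.fst = v ∧ d.snd ∈ A ∧ (R.next d).snd ∈ k := by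
  obtain ⟨a, haA, hva⟩ := hG.exists_adj hk hA hkA hbA hv
  obtain ⟨b, hbB', hvb⟩ := hG.exists_adj hk hB hkB hbB hv
  obtain ⟨n, hn⟩ := ((R.sameCycle_iff ⟨(v, a), hva⟩ ⟨(v, b), hvb⟩).2 rfl).exists_nat_pow_eq
  -- Rotate from a neighbour in `A` towards one in `B`. At the first exit the successor is adjacent
  -- to a vertex of `A`, so it lies in `k`.
  have key : ∀ n : ℕ, ∀ d : G.Dart, d.fst = v → d.snd ∈ A → ((R.next ^ n) d).snd ∉ A →
      ∃ d : G.Dart, d.fst = v ∧ d.snd ∈ A ∧ (R.next d).snd ∈ k := by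
    intro n
    induction n with
    | zero => exact fun d _ h h' => absurd h h'
    | succ n ih =>
      intro d hd hdA hdn
      by_cases h : (R.next d).snd ∈ A
      · exact ih (R.next d) (by rw [R.fst_next, hd]) h (by rwa [pow_succ] at hdn)
      · exact ⟨d, hd, hdA, hbA _ hdA _ (hG.adj_snd_next hk.three_le_card hR d) h⟩
  refine key n ⟨(v, a), hva⟩ rfl haA ?_
  rw [hn]
  exact Set.disjoint_right.1 hAB hbB'

/-- The parts are removed one by one; `hBC` ensures that each clique is still present when its own
part is removed. -/
lemma IsMaximalPlanar.ncard_edgesIn_compl_biUnion {ι : Type*} (hG : G.IsMaximalPlanar)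
    (hn : 3 ≤ Nat.card V) (J : Finset ι) {B : ι → Set V} {C : ι → Finset V}
    (hC : ∀ k ∈ J, G.IsNClique 3 (C k)) (hB : ∀ k ∈ J, G.BoundaryIn (B k) (C k))
    (hBC : ∀ k ∈ J, ∀ l ∈ J, Disjoint (B l) (C k : Set V)) :
    3 * ((⋃ k ∈ J, B k)ᶜ).ncard ≤ (G.edgesIn (⋃ k ∈ J, B k)ᶜ).ncard + 6 := by
  classical
  induction J using Finset.induction_on with
  | empty => simp [hG.ncard_edgesIn_univ hn, Set.ncard_univ]
  | insert a s _ ih =>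
    rw [Finset.set_biUnion_insert, Set.union_comm, Set.compl_union, ← Set.sdiff_eq]
    have ha := Finset.mem_insert_self a s
    refine hG.prop.ncard_edgesIn_diff (hC a ha)
      (ih (fun k hk => hC k (Finset.mem_insert_of_mem hk))
        (fun k hk => hB k (Finset.mem_insert_of_mem hk))
        (fun k hk l hl => hBC k (Finset.mem_insert_of_mem hk) l (Finset.mem_insert_of_mem hl)))
      ?_ (hBC a ha a ha) (hB a ha)
    intro x hx
    simp only [Set.mem_compl_iff, Set.mem_iUnion, not_exists]
    exact fun l hl h => Set.disjoint_left.1 (hBC a ha l (Finset.mem_insert_of_mem hl)) h hx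

/-- If `I` split, then with `O` there would be three parts attached to `k`. The rotation about a
vertex of `k` leaves each of them through a different vertex of `k`, but only two others exist. -/
theorem IsMaximalPlanar.connectedIn_of_divides (hG : G.IsMaximalPlanar) {k : Finset V}
    (hk : G.IsNClique 3 k) {I O : Set V} (h : G.Divides (k : Set V) I O) (hO : O.Nonempty) :
    G.ConnectedIn I := by
  classical
  intro A hA hne hne'
  by_contra! hcon
  obtain ⟨R, hR⟩ := hG.prop
  obtain ⟨v, hv⟩ : k.Nonempty := by
    rw [← Finset.card_pos, hk.card_eq]
    norm_num
  have hkI := h.disjoint_left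
  have hkA : Disjoint A (k : Set V) := hkI.mono_left hA
  have hkB : Disjoint (I \ A) (k : Set V) := hkI.mono_left Set.sdiff_subset
  have hbA : G.BoundaryIn A (k : Set V) := by
    intro a ha x hadj hx
    refine h.boundaryIn a (hA ha) x hadj fun hxI => ?_
    exact hcon a ha x ⟨hxI, hx⟩ hadj
  have hbB : G.BoundaryIn (I \ A) (k : Set V) := by
    intro a ha x hadj hx
    refine h.boundaryIn a ha.1 x hadj fun hxI => ?_
    have : x ∈ A := by
      by_contra hxA
      exact hx ⟨hxI, hxA⟩
    exact hcon x this a ha hadj.symm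
  have hAB : Disjoint A (I \ A) := Set.disjoint_sdiff_right
  have hAO : Disjoint A O := h.disjoint.mono_left hA
  have hBO : Disjoint (I \ A) O := h.disjoint.mono_left Set.sdiff_subset
  have hkO := h.disjoint_right
  have hbO := h.symm.boundaryIn
  obtain ⟨d₁, h1, h1', h1''⟩ :=
    hG.exists_dart_next_mem hk hR hne hkA hbA hne' hkB hbB hAB hv
  obtain ⟨d₂, h2, h2', h2''⟩ :=
    hG.exists_dart_next_mem hk hR hne' hkB hbB hO hkO hbO hBO hv
  obtain ⟨d₃, h3, h3', h3''⟩ :=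
    hG.exists_dart_next_mem hk hR hO hkO hbO hne hkA hbA hAO.symm hv
  have hinj : ∀ d e : G.Dart, d.fst = v → e.fst = v → (R.next d).snd = (R.next e).snd →
      d.snd = e.snd := by
    intro d e hd he hde
    have : R.next d = R.next e :=
      Dart.ext _ _ (Prod.ext (by rw [R.fst_next, R.fst_next, hd, he]) hde)
    rw [R.next.injective this]
  obtain ⟨b, c, hbc, hk'⟩ : ∃ b c, b ≠ c ∧ k.erase v = {b, c} := by
    rw [← Finset.card_eq_two, Finset.card_erase_of_mem hv, hk.card_eq]
  have hmem : ∀ d : G.Dart, d.fst = v → (R.next d).snd ∈ k →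
      (R.next d).snd = b ∨ (R.next d).snd = c := by
    intro d hd hdk
    have : (R.next d).snd ∈ k.erase v := by
      refine Finset.mem_erase.2 ⟨?_, hdk⟩
      rw [← hd, ← R.fst_next d]
      exact (R.next d).snd_ne_fst
    simpa [hk'] using this
  have h12 : (R.next d₁).snd ≠ (R.next d₂).snd := fun h =>
    Set.disjoint_left.1 hAB h1' (hinj d₁ d₂ h1 h2 h ▸ h2')
  have h23 : (R.next d₂).snd ≠ (R.next d₃).snd := fun h =>
    Set.disjoint_left.1 hBO h2' (hinj d₂ d₃ h2 h3 h ▸ h3')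
  have h13 : (R.next d₁).snd ≠ (R.next d₃).snd := fun h =>
    Set.disjoint_left.1 hAO h1' (hinj d₁ d₃ h1 h3 h ▸ h3')
  rcases hmem d₁ h1 h1'' with e1 | e1 <;> rcases hmem d₂ h2 h2'' with e2 | e2 <;>
    rcases hmem d₃ h3 h3'' with e3 | e3 <;> simp_all

end SimpleGraph

namespace SimpleGraph

variable {V : Type*} [Finite V] {G : SimpleGraph V}

/-! ### The order of the 3-cliques by their interiors -/

namespace CliqueDirection

variable (D : CliqueDirection G)

omit [Finite V] in
lemma divides (k : ThreeClique G) : G.Divides (k.1 : Set V) (D.interior k) (D.exterior k) :=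
  (D.isInteriorExterior k).divides

lemma exterior_nonempty {k : ThreeClique G} (h : (D.interior k).Nonempty) :
    (D.exterior k).Nonempty := by
  rw [← Set.ncard_pos] at h ⊢
  exact h.trans_le (D.isInteriorExterior k).ncard_le

lemma connectedIn_interior (hG : G.IsMaximalPlanar) (k : ThreeClique G) :
    G.ConnectedIn (D.interior k) := by
  intro A hA hne hne'
  exact hG.connectedIn_of_divides k.2 (D.divides k) (D.exterior_nonempty (hne.mono hA)) A hA hne hne'

lemma connectedIn_exterior (hG : G.IsMaximalPlanar) (k : ThreeClique G) :
    G.ConnectedIn (D.exterior k) := by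
  rcases (D.interior k).eq_empty_or_nonempty with h | h
  · have hO : D.exterior k = (k.1 : Set V)ᶜ := by
      rw [← (D.divides k).union_eq, h, Set.empty_union]
    rw [hO]
    refine connectedIn_compl fun hs => ?_
    exact ((D.isInteriorExterior k).nonempty hs).1.ne_empty h
  · exact hG.connectedIn_of_divides k.2 (D.divides k).symm h

lemma exists_adj_exterior (hG : G.IsMaximalPlanar) {k : ThreeClique G}
    (h : (D.interior k).Nonempty) {v : V} (hv : v ∈ k.1) : ∃ w ∈ D.exterior k, G.Adj v w :=
  hG.exists_adj k.2 (D.exterior_nonempty h) (D.divides k).disjoint_right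
    (D.divides k).symm.boundaryIn hv

omit [Finite V] in
lemma compl_exterior (k : ThreeClique G) :
    (D.exterior k)ᶜ = (k.1 : Set V) ∪ D.interior k := by
  ext x
  rw [Set.mem_compl_iff, Set.mem_union]
  constructor
  · intro hx
    by_contra! h
    exact ((D.divides k).mem_or h.1).elim h.2 hx
  · rintro (h | h) hx
    · exact Set.disjoint_left.1 (D.divides k).disjoint_right hx h
    · exact Set.disjoint_left.1 (D.divides k).disjoint h hx

omit [Finite V] in
lemma compl_interior (k : ThreeClique G) :
    ((k.1 : Set V) ∪ D.interior k)ᶜ = D.exterior k := by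
  rw [← compl_exterior, compl_compl]

omit [Finite V] in
lemma eq_of_subset {j k : ThreeClique G} (h : (j.1 : Set V) ⊆ k.1) : j = k :=
  Subtype.ext (Finset.eq_of_subset_of_card_le (Finset.coe_subset.1 h)
    (by rw [j.2.card_eq, k.2.card_eq]))

omit [Finite V] in
/-- A 3-clique with a vertex in the interior of `k` lies in `k` and its interior. -/
lemma subset_of_mem_interior {j k : ThreeClique G} {v : V} (hj : v ∈ j.1)
    (hk : v ∈ D.interior k) : (j.1 : Set V) ⊆ (k.1 : Set V) ∪ D.interior k := by
  intro x hx
  by_cases hxv : x = v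
  · exact Or.inr (hxv ▸ hk)
  · by_contra h
    have hx' : x ∈ D.exterior k := by
      rw [← compl_interior]
      exact h
    exact (D.divides k).not_adj hk hx' (j.2.isClique hj hx (Ne.symm hxv))

/-- The exterior of `i` is connected and avoids `j`, so it lies on one side of `j`. In the exterior
of `j`, taking complements finishes; in the interior of `j`, the sizes contradict each other. -/
lemma below_of_subset (hG : G.IsMaximalPlanar) {i j : ThreeClique G}
    (h : (j.1 : Set V) ⊆ (i.1 : Set V) ∪ D.interior i) : D.Below j i := by
  rcases (D.interior j).eq_empty_or_nonempty with hj | hj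
  · rw [Below, hj, Set.union_empty]
    exact h
  by_cases hij : j = i
  · exact hij ▸ subset_rfl
  have hi : (D.interior i).Nonempty := by
    rw [Set.nonempty_iff_ne_empty]
    intro hi
    rw [hi, Set.union_empty] at h
    exact hij (eq_of_subset h)
  have hOj : Disjoint (D.exterior i) (j.1 : Set V) := by
    rw [← compl_interior]
    exact Set.disjoint_compl_left_iff_subset.2 h
  have hside : D.exterior i ⊆ D.interior j ∨ D.exterior i ⊆ D.exterior j := by
    by_contra! hcon
    obtain ⟨⟨x, hx, hx'⟩, y, hy, hy'⟩ := hcon.imp Set.not_subset.1 Set.not_subset.1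
    have hmem : ∀ z ∈ D.exterior i, z ∈ D.interior j ∨ z ∈ D.exterior j :=
      fun z hz => (D.divides j).mem_or (Set.disjoint_left.1 hOj hz)
    obtain ⟨a, ha, b, hb, hab⟩ := D.connectedIn_exterior hG i (D.exterior i ∩ D.interior j)
      Set.inter_subset_left ⟨y, hy, (hmem y hy).resolve_right hy'⟩ ⟨x, hx, fun h => hx' h.2⟩
    exact (D.divides j).not_adj ha.2
      ((hmem b hb.1).resolve_left fun h => hb.2 ⟨hb.1, h⟩) hab
  obtain hside | hside := hside
  · exfalso
    have hi' : ∀ v ∈ i.1, v ∉ j.1 → v ∈ D.interior j := by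
      intro v hv hvj
      obtain ⟨w, hw, hvw⟩ := D.exists_adj_exterior hG hi hv
      exact ((D.divides j).mem_or hvj).resolve_right
        fun h => (D.divides j).not_adj (hside hw) h hvw.symm
    obtain ⟨v, hv, hvj⟩ : ∃ v ∈ i.1, v ∉ j.1 := by
      by_contra! hcon
      exact hij (eq_of_subset (j := i) (k := j) hcon).symm
    have h1 : (D.exterior i).ncard < (D.interior j).ncard := by
      refine Set.ncard_lt_ncard ⟨hside, fun h' => ?_⟩
      exact Set.disjoint_left.1 (D.divides i).disjoint_right (h' (hi' v hv hvj)) hv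
    have h2 : (D.exterior j).ncard ≤ (D.interior i).ncard := by
      refine Set.ncard_le_ncard fun x hx => ?_
      have hxj : x ∉ D.interior j := Set.disjoint_right.1 (D.divides j).disjoint hx
      have hxj' : x ∉ j.1 := Set.disjoint_left.1 (D.divides j).disjoint_right hx
      exact ((D.divides i).mem_or fun hxi => hxj (hi' x hxi hxj')).resolve_right
        fun hxO => hxj (hside hxO)
    have h3 := (D.isInteriorExterior i).ncard_le
    have h4 := (D.isInteriorExterior j).ncard_le
    -- The cycle is |ext i| < |int j| ≤ |ext j| ≤ |int i| ≤ |ext i|; it is strict because a vertex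
    -- of `i` outside `j` lies in the interior of `j`.
    omega
  · rw [Below, ← compl_exterior, ← compl_exterior]
    exact Set.compl_subset_compl.2 hside

/-- Equal unions have equal exteriors. If the interior of `j` is nonempty, each vertex of `j` has a
neighbour in that exterior, so it cannot be interior to `k`; this gives `j ⊆ k`. -/
lemma below_antisymm (hG : G.IsMaximalPlanar) {j k : ThreeClique G} (hjk : D.Below j k)
    (hkj : D.Below k j) : j = k := by
  have heq := hjk.antisymm hkj
  rcases (D.interior j).eq_empty_or_nonempty with hj | hj
  · have : (k.1 : Set V) ⊆ j.1 := by
      intro x hx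
      have : x ∈ (j.1 : Set V) ∪ D.interior j := hkj (Or.inl hx)
      simpa [hj] using this
    exact (eq_of_subset this).symm
  · refine eq_of_subset fun x hx => ?_
    have hO : D.exterior j = D.exterior k := by
      rw [← compl_interior, ← compl_interior, heq]
    obtain ⟨w, hw, hxw⟩ := D.exists_adj_exterior hG hj hx
    rw [hO] at hw
    refine (hjk (Or.inl hx)).resolve_right fun hxk => ?_
    exact (D.divides k).not_adj hxk hw hxw

/-- Everything strictly below `i` is below something covered by `i`. -/
lemma exists_mem_incomingNeighbors (hG : G.IsMaximalPlanar) {i f : ThreeClique G}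
    (hf : D.Below f i) (hne : f ≠ i) : ∃ j ∈ D.incomingNeighbors i, D.Below f j := by
  have hfin : {j | D.Below f j ∧ D.Below j i ∧ j ≠ i}.Finite := by
    have : Finite (Finset V) := by
      classical
      have := Fintype.ofFinite V
      infer_instance
    exact Set.toFinite _
  obtain ⟨j, ⟨hfj, hji, hj⟩, hmax⟩ := Set.exists_max_image _
    (fun j : ThreeClique G => ((j.1 : Set V) ∪ D.interior j).ncard) hfin
    ⟨f, subset_rfl, hf, hne⟩
  refine ⟨j, ⟨hj, hji, fun z hjz hzi => ?_⟩, hfj⟩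
  by_cases hz : z = i
  · exact Or.inr hz
  · have := Set.eq_of_subset_of_ncard_le hjz (hmax z ⟨hfj.trans hjz, hzi, hz⟩)
    exact Or.inl (D.below_antisymm hG this.symm.subset hjz)

/-! ### The union as the complement of the cut-off parts -/

open Classical in
/-- The part that is cut off from the union of `i` with its incoming neighbours along `k`. -/
noncomputable def cutOff (i k : ThreeClique G) : Set V :=
  if k = i then D.exterior i else D.interior k

open Classical in
/-- `i` and its incoming neighbours. -/
noncomputable def unionCliques (i : ThreeClique G) : Finset (ThreeClique G) :=
  have : Finite (Finset V) := by
    have := Fintype.ofFinite V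
    infer_instance
  insert i (Set.toFinite (D.incomingNeighbors i)).toFinset

lemma mem_unionCliques {i k : ThreeClique G} :
    k ∈ D.unionCliques i ↔ k = i ∨ k ∈ D.incomingNeighbors i := by
  simp [unionCliques]

lemma subset_unionVerts {i k : ThreeClique G} (hk : k ∈ D.unionCliques i) :
    (k.1 : Set V) ⊆ D.unionVerts i := by
  rcases D.mem_unionCliques.1 hk with rfl | hk
  · exact Set.subset_union_left
  · exact (Set.subset_biUnion_of_mem (u := fun j : ThreeClique G => (j.1 : Set V)) hk).trans
      Set.subset_union_right

omit [Finite V] in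
lemma boundaryIn_cutOff (i k : ThreeClique G) : G.BoundaryIn (D.cutOff i k) (k.1 : Set V) := by
  unfold cutOff
  split_ifs with h
  · rw [h]
    exact (D.divides i).symm.boundaryIn
  · exact (D.divides k).boundaryIn

/-- What is left when a clique and the part cut off along it are removed. -/
lemma connectedIn_compl_cutOff (hG : G.IsMaximalPlanar) (i k : ThreeClique G) :
    G.ConnectedIn ((k.1 : Set V) ∪ D.cutOff i k)ᶜ := by
  unfold cutOff
  split_ifs with h
  · have : ((k.1 : Set V) ∪ D.exterior i)ᶜ = D.interior i := by
      rw [h, Set.compl_union, compl_exterior, Set.inter_union_distrib_left, Set.compl_inter_self,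
        Set.empty_union, Set.inter_eq_right]
      exact fun x hx hxi => Set.disjoint_left.1 (D.divides i).disjoint_left hx hxi
    rw [this]
    exact D.connectedIn_interior hG i
  · rw [compl_interior]
    exact D.connectedIn_exterior hG k

variable {i : ThreeClique G}

omit [Finite V] in
lemma interior_nonempty (hi : (D.incomingNeighbors i).Nonempty) : (D.interior i).Nonempty := by
  obtain ⟨j, hne, hji, -⟩ := hi
  rw [Set.nonempty_iff_ne_empty]
  intro h
  refine hne (eq_of_subset fun x hx => ?_)
  have : x ∈ (i.1 : Set V) ∪ D.interior i := hji (Or.inl hx)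
  simpa [h] using this

/-- The union of `i` and its incoming neighbours is what remains when the exterior of `i` and
the interiors of its incoming neighbours are removed. -/
theorem unionVerts_eq (hG : G.IsMaximalPlanar) (hi : (D.incomingNeighbors i).Nonempty) :
    D.unionVerts i = (⋃ k ∈ D.unionCliques i, D.cutOff i k)ᶜ := by
  have hI := D.interior_nonempty hi
  have hmem : ∀ v, v ∈ (⋃ k ∈ D.unionCliques i, D.cutOff i k)ᶜ ↔
      v ∈ (i.1 : Set V) ∪ D.interior i ∧ ∀ j ∈ D.incomingNeighbors i, v ∉ D.interior j := by
    intro v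
    rw [← compl_exterior]
    simp only [Set.mem_compl_iff, Set.mem_iUnion, not_exists, mem_unionCliques]
    constructor
    · intro h
      refine ⟨?_, fun j hj => ?_⟩
      · have := h i (Or.inl rfl)
        rwa [cutOff, if_pos rfl] at this
      · have := h j (Or.inr hj)
        rwa [cutOff, if_neg hj.1] at this
    · rintro ⟨h, h'⟩ k hk
      rw [cutOff]
      split_ifs with hki
      · exact h
      · exact h' k (hk.resolve_left hki)
  ext v
  rw [hmem]
  constructor
  · intro hv
    rcases hv with hv | hv
    · refine ⟨Or.inl hv, fun j hj hvj => ?_⟩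
      -- A vertex of `i` has a neighbour in the exterior of `i`, hence in that of `j`, so it is not
      -- interior to `j`.
      obtain ⟨w, hw, hvw⟩ := D.exists_adj_exterior hG hI hv
      have hw' : w ∈ D.exterior j := by
        rw [← compl_interior] at hw ⊢
        exact fun h => hw (hj.2.1 h)
      exact (D.divides j).not_adj hvj hw' hvw
    · obtain ⟨j', hj', hvj'⟩ := Set.mem_iUnion₂.1 hv
      refine ⟨hj'.2.1 (Or.inl hvj'), fun j hj hvj => ?_⟩
      -- A vertex of `j'` interior to `j` would place `j'` below `j`, against the covering of `j'`
      -- by `i`.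
      have hbelow := D.below_of_subset hG (D.subset_of_mem_interior hvj' hvj)
      rcases hj'.2.2 j hbelow hj.2.1 with h | h
      · rw [h] at hvj
        exact Set.disjoint_left.1 (D.divides j').disjoint_left hvj hvj'
      · exact hj.1 h
  · rintro ⟨hv | hv, h⟩
    · exact Or.inl hv
    · obtain ⟨k, hk, hvk⟩ := hG.exists_threeClique i.2.three_le_card v
      have hne : (⟨k, hk⟩ : ThreeClique G) ≠ i := by
        rintro rfl
        exact Set.disjoint_left.1 (D.divides _).disjoint_left hv hvk
      have hbelow := D.below_of_subset hG
        (D.subset_of_mem_interior (j := ⟨k, hk⟩) hvk hv)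
      obtain ⟨j, hj, hkj⟩ := D.exists_mem_incomingNeighbors hG hbelow hne
      exact Or.inr (Set.mem_iUnion₂.2 ⟨j, hj, (hkj (Or.inl hvk)).resolve_right (h j hj)⟩)

lemma disjoint_cutOff_unionVerts (hG : G.IsMaximalPlanar) (hi : (D.incomingNeighbors i).Nonempty)
    {k : ThreeClique G} (hk : k ∈ D.unionCliques i) :
    Disjoint (D.cutOff i k) (D.unionVerts i) := by
  rw [D.unionVerts_eq hG hi, Set.disjoint_compl_right_iff_subset]
  exact Set.subset_biUnion_of_mem (u := fun k => D.cutOff i k) hk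

/-- The 3-cliques of the union are `i` and its incoming neighbours. -/
theorem mem_unionCliques_of_subset (hG : G.IsMaximalPlanar)
    (hi : (D.incomingNeighbors i).Nonempty) {k : ThreeClique G}
    (hk : (k.1 : Set V) ⊆ D.unionVerts i) : k ∈ D.unionCliques i := by
  rw [mem_unionCliques]
  by_cases hki : k = i
  · exact Or.inl hki
  have hcut : ∀ j ∈ D.unionCliques i, ∀ x ∈ k.1, x ∉ D.cutOff i j := fun j hj x hx h =>
    Set.disjoint_left.1 (D.disjoint_cutOff_unionVerts hG hi hj) h (hk hx)
  have hbelow : D.Below k i := by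
    refine D.below_of_subset hG fun x hx => ?_
    rw [← compl_exterior]
    have := hcut i (D.mem_unionCliques.2 (Or.inl rfl)) x hx
    rwa [cutOff, if_pos rfl] at this
  obtain ⟨j, hj, hkj⟩ := D.exists_mem_incomingNeighbors hG hbelow hki
  have : k = j := by
    refine eq_of_subset fun x hx => (hkj (Or.inl hx)).resolve_right ?_
    have := hcut j (D.mem_unionCliques.2 (Or.inr hj)) x hx
    rwa [cutOff, if_neg hj.1] at this
  exact Or.inr (this ▸ hj)

theorem isMaximalPlanar_unionGraph (hG : G.IsMaximalPlanar)
    (hi : (D.incomingNeighbors i).Nonempty) : (D.unionGraph i).IsMaximalPlanar := by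
  have h3 : 3 ≤ (D.unionVerts i).ncard :=
    i.2.three_le_ncard (D.subset_unionVerts (D.mem_unionCliques.2 (Or.inl rfl)))
  refine (hG.prop.induce _).isMaximalPlanar (by rwa [Nat.card_coe_set_eq]) ?_
  rw [card_edgeSet_induce, Nat.card_coe_set_eq]
  have := hG.ncard_edgesIn_compl_biUnion i.2.three_le_card (D.unionCliques i)
    (B := D.cutOff i) (C := Subtype.val) (fun k _ => k.2) (fun k _ => D.boundaryIn_cutOff i k)
    (fun k hk l hl => (D.disjoint_cutOff_unionVerts hG hi hl).mono_right (D.subset_unionVerts hk))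
  rwa [← D.unionVerts_eq hG hi] at this

theorem not_isSeparating_unionGraph (hG : G.IsMaximalPlanar)
    (hi : (D.incomingNeighbors i).Nonempty) (t : ThreeClique (D.unionGraph i)) :
    ¬ (D.unionGraph i).IsSeparating (t.1 : Set (D.unionVerts i)) := by
  rintro ⟨S, S', hdiv, ⟨x, hx⟩, y, hy⟩
  have htc : G.IsNClique 3 (t.1.map (Function.Embedding.subtype (· ∈ D.unionVerts i))) :=
    t.2.map.mono (map_comap_le _ _)
  let k : ThreeClique G := ⟨_, htc⟩
  have hmemk : ∀ x : D.unionVerts i, x.1 ∈ k.1 ↔ x ∈ t.1 := by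
    intro x
    simp [k]
  have hkU : (k.1 : Set V) ⊆ D.unionVerts i := by
    intro x hx
    simp only [k, Finset.coe_map, Set.mem_image] at hx
    obtain ⟨y, -, rfl⟩ := hx
    exact y.2
  have hk := D.mem_unionCliques_of_subset hG hi hkU
  -- Removing `k` with its cut-off part leaves the opposite, connected side; the other cut-off parts
  -- are then deleted from it.
  have hset : D.unionVerts i \ (k.1 : Set V) =
      ((k.1 : Set V) ∪ D.cutOff i k)ᶜ \ ⋃ l ∈ D.unionCliques i, D.cutOff i l := by
    rw [D.unionVerts_eq hG hi]
    ext x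
    have : x ∈ D.cutOff i k → x ∈ ⋃ l ∈ D.unionCliques i, D.cutOff i l :=
      fun h => Set.mem_biUnion hk h
    simp only [Set.mem_sdiff, Set.mem_compl_iff, Set.mem_union]
    tauto
  have hconn : G.ConnectedIn (D.unionVerts i \ (k.1 : Set V)) := by
    rw [hset]
    exact (D.connectedIn_compl_cutOff hG i k).diff_biUnion _ (C := fun l => (l.1 : Set V))
      (fun l _ => l.2.isClique) (fun l _ => D.boundaryIn_cutOff i l)
  have hnot : ∀ {x : D.unionVerts i}, x ∈ S ∨ x ∈ S' → x.1 ∉ k.1 := by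
    rintro x (hx | hx) h
    · exact Set.disjoint_left.1 hdiv.disjoint_left hx ((hmemk x).1 h)
    · exact Set.disjoint_left.1 hdiv.disjoint_right hx ((hmemk x).1 h)
  obtain ⟨_, ⟨a, ha, rfl⟩, b, ⟨⟨hbU, hbk⟩, hb⟩, hab⟩ := hconn (Subtype.val '' S)
    (by
      rintro _ ⟨a, ha, rfl⟩
      exact ⟨a.2, hnot (Or.inl ha)⟩)
    ⟨_, x, hx, rfl⟩
    ⟨y.1, ⟨y.2, hnot (Or.inr hy)⟩, by
      rintro ⟨a, ha, hay⟩
      rw [Subtype.ext hay] at ha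
      exact Set.disjoint_left.1 hdiv.disjoint ha hy⟩
  have hbS : (⟨b, hbU⟩ : D.unionVerts i) ∈ S' :=
    (hdiv.mem_or fun h => hbk ((hmemk ⟨b, hbU⟩).2 h)).resolve_left fun h => hb ⟨_, h, rfl⟩
  exact hdiv.not_adj ha hbS hab

end CliqueDirection

end SimpleGraph

theorem mainTheorem3 {V : Type*} [Finite V] (G : SimpleGraph V) (hG : G.IsMaximalPlanar)
    (D : G.CliqueDirection) (i : G.ThreeClique) (hi : (D.incomingNeighbors i).Nonempty) :
    (D.unionGraph i).IsBubble :=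
  ⟨D.isMaximalPlanar_unionGraph hG hi, D.not_isSeparating_unionGraph hG hi⟩
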